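/- Let $n,m\ge 1$ and $0\le k\le n$ be integers. Put $N=\gcd(n,k)$, $n'=n/N$, $k'=k/N$, and let $\bar k'$ be the unique integer with $0\le \bar k'<n'$ and $k'\bar k'\equiv 1 \pmod{n'}$. For an integer $s\ge 1$ let $P_s(x)$ be the $s\times s$ matrix with entries $1$ just below the diagonal, $x$ in the upper right corner and $0$ elsewhere (so $P_1(x)=(x)$). For an array $a=(a_{ij})_{1\le i\le r,\,1\le j\le s}$ of complex numbers and an integer $l\ge 0$ put $A_i(x)=P_s(x)+\mathrm{diag}(a_{i1},\dots,a_{is})$ and $$\psi_{s,r,l}(a)=\det\bigl(A_1(x)A_2(x)\cdots A_r(x)\,P_s(x)^l-y\bigr)\in\mathbb C[x,y].$$ For $q=(q_{ij})_{1\le i\le m,\,1\le j\le n}\in\mathbb C^{mn}$ let $\psi(q)=\psi_{n,m,k}(q)$ be the spectral polynomial of the network, and let $\tilde\psi(q)=\psi_{mn',N,\bar k'm}(\tilde q)$ be the spectral polynomial of the transposed network, where $\tilde q$ is the array with $N$ rows of length $mn'$ whose row number $N+1-i$ is $$(q_{m,i},\dots,q_{1,i},\;q_{m,i+k},\dots,q_{1,i+k},\;\dots,\;q_{m,i-k},\dots,q_{1,i-k})\qquad(1\le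 i\le N),$$ that is, it is formed of the $n'$ consecutive blocks $(q_{m,i+tk},\dots,q_{1,i+tk})$, $t=0,1,\dots,n'-1$, the second index being taken modulo $n$. Then the affine map $T:\mathbb Z^2\to\mathbb Z^2$, $$T\begin{pmatrix} i\\ j\end{pmatrix}=\begin{pmatrix}\bar k'(k+m)\\ -n'k\end{pmatrix}+\begin{pmatrix}-\bar k' & (1-k'\bar k')/n'\\ n' & k'\end{pmatrix}\begin{pmatrix} i\\ j\end{pmatrix},$$ is a bijection, and $\psi(q)$ and $\tilde\psi(q)$ coincide up to the change of monomials $x^iy^j\mapsto x^ay^b$, $(a,b)=T(i,j)$, and signs. Precisely, there are polynomials $w_{i,j}$ with nonnegative integer coefficients in $mn$ variables, for $(i,j)\in\mathbb Z^2$, such that for all $q\in\mathbb C^{mn}$ and all $(i,j)\in\mathbb Z^2$, with $(a,b)=T(i,j)$, $$[x^iy^j]\,\psi(q)=(-1)^{(n-j-1)i+j}\,w_{i,j}(q),\qquad [x^ay^b]\,\tilde\psi(q)=(-1)^{(mn'-b-1)a+b}\,w_{i,j}(q),$$ where a coefficient $[x^iy^j]$ with a negative exponent is $0$. -/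

import Mathlib

namespace ToricNetwork

open Polynomial

/-- The `n × n` matrix `P(x)`: ones just below the diagonal and `x` in the upper right corner
(for `n = 1` this is the matrix `(x)`). The variable `x` is `Polynomial.X`; indices are 0-based. -/
noncomputable def shiftMatrix (R : Type*) [CommRing R] (n : ℕ) : Matrix (Fin n) (Fin n) R[X] :=
  Matrix.of fun i j =>
    if i.val = j.val + 1 then 1 else if i.val = 0 ∧ j.val + 1 = n then X else 0

/-- The matrix `Q_i(x)`: the matrix `P(x)` plus the diagonal matrix with the entries
`q_{i1}, …, q_{in}` of one row `v` of the array. -/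
noncomputable def factorMatrix {R : Type*} [CommRing R] {n : ℕ} (v : Fin n → R) :
    Matrix (Fin n) (Fin n) R[X] :=
  shiftMatrix R n + Matrix.diagonal fun j => C (v j)

/-- The Lax matrix `L(x) = Q_1(x) Q_2(x) ⋯ Q_m(x) P(x)^k`. -/
noncomputable def laxMatrix {R : Type*} [CommRing R] (m n k : ℕ) (q : Fin m → Fin n → R) :
    Matrix (Fin n) (Fin n) R[X] :=
  (List.ofFn fun i : Fin m => factorMatrix (q i)).prod * shiftMatrix R n ^ k

/-- The spectral polynomial `det (L(x) - y)`. It is an element of `R[x][y]`: the inner variable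
is `x`, the outer variable is `y`. -/
noncomputable def spectralPoly {R : Type*} [CommRing R] (m n k : ℕ) (q : Fin m → Fin n → R) :
    R[X][X] :=
  ((laxMatrix m n k q).map (C : R[X] → R[X][X]) - Matrix.scalar (Fin n) (X : R[X][X])).det

/-- The transposed array `q̃`, of size `N` by `m n'`, where `N = gcd(n, k)` and `n' = n / N`.
In 1-based indexing the row with number `N + 1 - i` is
`q_{m,i}, …, q_{1,i}, q_{m,i+k}, …, q_{1,i+k}, …, q_{m,i-k}, …, q_{1,i-k}`,
the second index being taken modulo `n`. -/
def transposedArray {R : Type*} (m n k : ℕ) [NeZero m] [NeZero n] (q : Fin m → Fin n → R) :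
    Fin (n.gcd k) → Fin (m * (n / n.gcd k)) → R :=
  fun r p =>
    q (Fin.ofNat m (m - 1 - p.val % m))
      (Fin.ofNat n ((n.gcd k - 1 - r.val) + (p.val / m) * k))

/-- The spectral polynomial `ψ̃(q) = det (Q̃_1(x) ⋯ Q̃_N(x) P̃(x)^{k̄' m} - y)` of the
transposed network; the matrices have size `m n'`. -/
noncomputable def transposedSpectralPoly {R : Type*} [CommRing R] (m n k kbar : ℕ)
    [NeZero m] [NeZero n] (q : Fin m → Fin n → R) : R[X][X] :=
  spectralPoly (n.gcd k) (m * (n / n.gcd k)) (kbar * m) (transposedArray m n k q)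

/-- The coefficient of `x^i y^j` for integers `i, j`; it is `0` if an exponent is negative. -/
noncomputable def intCoeff {R : Type*} [CommRing R] (f : R[X][X]) (p : ℤ × ℤ) : R :=
  if 0 ≤ p.1 ∧ 0 ≤ p.2 then (f.coeff p.2.toNat).coeff p.1.toNat else 0

/-- The affine map `(i, j) ↦ (k̄'(k + m), -n' k) + ((-k̄', (1 - k' k̄')/n'), (n', k')) (i, j)`,
where `n' = n / gcd(n, k)` and `k' = k / gcd(n, k)`. The division by `n'` is exact when
`k' k̄' ≡ 1` modulo `n'`. -/
def exponentMap (m n k kbar : ℕ) (p : ℤ × ℤ) : ℤ × ℤ :=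
  let n' : ℤ := ((n / n.gcd k : ℕ) : ℤ)
  let k' : ℤ := ((k / n.gcd k : ℕ) : ℤ)
  ((kbar : ℤ) * (k + m) + (-(kbar : ℤ) * p.1 + (1 - k' * kbar) / n' * p.2),
    -n' * k + (n' * p.1 + k' * p.2))

/-- The sign `(-1)^{(n - b - 1) a + b}` of the monomial `x^a y^b` in a spectral polynomial of
matrices of size `n`. -/
noncomputable def monomialSign (n : ℕ) (p : ℤ × ℤ) : ℂ :=
  (-1 : ℂ) ^ (((n : ℤ) - p.2 - 1) * p.1 + p.2)

end ToricNetwork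

/-! Both spectral polynomials compute the determinant of one difference operator. On the free module
of functions u on ℤ² that are multiplied by x⁻¹ under translation by (0, n) and by y⁻¹ under (m, k),
let D u(i, j) = u(i - 1, j) - u(i, j - 1) - c(i - 1, j) u(i, j), with c the periodic extension of q.
Modulo a translation, D u = 0 says u_i = Q_i u_{i+1} for the columns u_i = u(i, ·), and u_m = y⁻¹
P^k u_0. Eliminating columns gives det D = ± x^{-k} det(L(x) - y) (`det_networkOp`).

Exchanging the two coordinates and multiplying by (-1)^{r+p} preserves the form of D: the swap
exchanges the two neighbour terms, and the sign undoes the effect. The period lattice is rewritten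
in the basis (m n', 0), (k̄' m, N), whose multipliers define new variables X = ± x^{-k'} y^{n'} and
Y = ± x^e y^{k̄'}, where k' k̄' + e n' = 1. Hence x^{-k} ψ(x, y) = ± X^{-k̄' m} ψ̃(X, Y), and
comparing monomials gives T (`intCoeff_spectralPoly_transpose`), up to signs that are never
computed.

Positivity settles the signs. By Cauchy–Binet the s × s minors of L(x) have nonnegative coefficients
after x ↦ (-1)^{s+1} x, because this holds for each factor (`minorsIn_factorMatrix`). So for the
generic array each coefficient of ψ and of ψ̃, times its prescribed sign, is a polynomial over ℕ.
Two such polynomials that agree up to sign are equal (`eq_of_map_eq_sign_mul_map`). -/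

namespace ToricNetwork

open Polynomial

/-! ### Cauchy–Binet and minors of bidiagonal matrices. -/

section Minors

variable {R : Type*} [CommRing R]

/-- The Cauchy–Binet formula. -/
theorem det_mul_eq_sum_minors {s n : ℕ} [Fintype (Fin s ↪o Fin n)]
    (A : Matrix (Fin s) (Fin n) R) (B : Matrix (Fin n) (Fin s) R) :
    (A * B).det = ∑ h : Fin s ↪o Fin n, (A.submatrix id h).det * (B.submatrix h id).det := by
  classical
  have expand : (A * B).det =
      ∑ φ : Fin s → Fin n, (∏ i, A i (φ i)) * (B.submatrix φ id).det := by
    have h1 : (A * B).det = Matrix.detRowAlternating (fun i => ∑ l, A i l • B l) := by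
      change Matrix.det _ = Matrix.det _
      congr 1
      ext i j
      simp [Matrix.mul_apply, Finset.sum_apply]
    rw [h1, ← AlternatingMap.coe_multilinearMap, MultilinearMap.map_sum]
    refine Finset.sum_congr rfl fun φ _ => ?_
    exact Matrix.det_mul_column (fun i => A i (φ i)) (B.submatrix φ id)
  -- A non-injective φ repeats a row of B, so its term vanishes.
  have restrict : (∑ φ : Fin s → Fin n, (∏ i, A i (φ i)) * (B.submatrix φ id).det) =
      ∑ φ : Fin s ↪ Fin n, (∏ i, A i (φ i)) * (B.submatrix φ id).det := by
    symm
    refine Finset.sum_of_injOn (fun φ : Fin s ↪ Fin n => (φ : Fin s → Fin n))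
      (DFunLike.coe_injective.injOn) (by simp) ?_ (by simp)
    intro φ _ hφ
    have : ¬ Function.Injective φ := fun h => hφ ⟨⟨φ, h⟩, by simp, rfl⟩
    obtain ⟨a, b, hab, hne⟩ : ∃ a b, φ a = φ b ∧ a ≠ b := by
      simpa [Function.Injective] using this
    rw [Matrix.det_zero_of_row_eq hne (by ext j; simp [hab]), mul_zero]
  -- Every injection is uniquely an increasing one precomposed with a permutation, found by sorting.
  let Ψ : (Fin s ↪o Fin n) × Equiv.Perm (Fin s) → (Fin s ↪ Fin n) :=
    fun p => p.2.toEmbedding.trans p.1.toEmbedding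
  have hΨ : Function.Bijective Ψ := by
    constructor
    · rintro ⟨h, σ⟩ ⟨h', σ'⟩ he
      have hfun : ∀ i, h (σ i) = h' (σ' i) := fun i => DFunLike.congr_fun he i
      have hr : h = h' := by
        rw [← OrderEmbedding.range_inj, ← σ.surjective.range_comp h,
          ← σ'.surjective.range_comp h']
        exact congrArg Set.range (_root_.funext hfun)
      subst hr
      have : σ = σ' := Equiv.ext fun i => h.injective (hfun i)
      rw [this]
    · intro φ
      let σ := Tuple.sort φ
      have hm : StrictMono (φ ∘ σ) :=
        (Tuple.monotone_sort φ).strictMono_of_injective (φ.injective.comp σ.injective)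
      refine ⟨(OrderEmbedding.ofStrictMono _ hm, σ⁻¹), ?_⟩
      ext i
      simp [Ψ]
  rw [expand, restrict, ← Function.Bijective.sum_comp hΨ, Fintype.sum_prod_type]
  refine Finset.sum_congr rfl fun h _ => ?_
  have hB : ∀ σ : Equiv.Perm (Fin s), (B.submatrix (Ψ (h, σ)) id).det =
      ((Equiv.Perm.sign σ : ℤ) : R) * (B.submatrix h id).det := by
    intro σ
    rw [← Matrix.det_permute]
    rfl
  simp_rw [hB, ← mul_assoc]
  rw [← Finset.sum_mul]
  congr 1
  rw [← Matrix.det_transpose, Matrix.det_apply']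
  refine Finset.sum_congr rfl fun σ _ => ?_
  rw [mul_comm]
  rfl

/-- All `s × s` minors of `M` lie in the subsemiring `T`. -/
def MinorsIn (T : Subsemiring R) (s : ℕ) {n : ℕ} (M : Matrix (Fin n) (Fin n) R) : Prop :=
  ∀ f g : Fin s ↪o Fin n, (M.submatrix f g).det ∈ T

theorem MinorsIn.mul {T : Subsemiring R} {s n : ℕ} {M M' : Matrix (Fin n) (Fin n) R}
    (h : MinorsIn T s M) (h' : MinorsIn T s M') : MinorsIn T s (M * M') := by
  classical
  intro f g
  have := Fintype.ofFinite (Fin s ↪o Fin n)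
  rw [← Matrix.submatrix_mul_equiv M M' f (Equiv.refl _) g, det_mul_eq_sum_minors]
  exact sum_mem fun k _ => mul_mem (h f k) (h' k g)

theorem MinorsIn.one (T : Subsemiring R) (s n : ℕ) :
    MinorsIn T s (1 : Matrix (Fin n) (Fin n) R) := by
  intro f g
  by_cases hfg : f = g
  · subst hfg
    rw [Matrix.submatrix_one f f.injective, Matrix.det_one]
    exact one_mem T
  -- Distinct index sets of equal size: some row index is missing from the columns, which gives a
  -- zero row.
  · have hr : ¬ Set.range f ⊆ Set.range g := by
      intro hsub
      apply hfg
      rw [← OrderEmbedding.range_inj]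
      refine Set.eq_of_subset_of_ncard_le hsub ?_
      simp [Set.ncard_range_of_injective, f.injective, g.injective]
    obtain ⟨_, ⟨i, rfl⟩, hi⟩ := Set.not_subset.1 hr
    rw [Matrix.det_eq_zero_of_row_eq_zero i]
    · exact zero_mem T
    · intro j
      rw [Matrix.submatrix_apply, Matrix.one_apply_ne]
      exact fun h => hi ⟨j, h.symm⟩

theorem MinorsIn.list_prod {T : Subsemiring R} {s n : ℕ} {l : List (Matrix (Fin n) (Fin n) R)}
    (h : ∀ M ∈ l, MinorsIn T s M) : MinorsIn T s l.prod := by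
  induction l with
  | nil => exact MinorsIn.one T s n
  | cons M l ih =>
    rw [List.prod_cons]
    exact (h M (by simp)).mul (ih fun M' hM' => h M' (by simp [hM']))

theorem MinorsIn.pow {T : Subsemiring R} {s n : ℕ} {M : Matrix (Fin n) (Fin n) R}
    (h : MinorsIn T s M) (k : ℕ) : MinorsIn T s (M ^ k) := by
  rw [← List.prod_replicate]
  exact MinorsIn.list_prod fun M' hM' => (List.eq_of_mem_replicate hM') ▸ h

/-- The lower bidiagonal matrix with diagonal `v` and ones below the diagonal. -/
def bidiagonal {n : ℕ} (v : Fin n → R) : Matrix (Fin n) (Fin n) R :=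
  Matrix.of fun i j => if i = j then v j else if i.val = j.val + 1 then 1 else 0

/-- Only the identity permutation contributes to the Leibniz expansion, so a minor is a product of
entries and no sign occurs. -/
theorem minorsIn_bidiagonal {T : Subsemiring R} {n : ℕ} {v : Fin n → R} (hv : ∀ j, v j ∈ T)
    (s : ℕ) : MinorsIn T s (bidiagonal v) := by
  intro f g
  have hmem : ∀ i j, bidiagonal v i j ∈ T := by
    intro i j
    simp only [bidiagonal, Matrix.of_apply]
    split_ifs
    exacts [hv j, one_mem T, zero_mem T]
  have hentry : ∀ i j, bidiagonal v i j ≠ 0 → j.val ≤ i.val ∧ i.val ≤ j.val + 1 := by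
    intro i j hij
    simp only [bidiagonal, Matrix.of_apply] at hij
    split_ifs at hij with h1 h2
    · subst h1; omega
    · omega
    · exact absurd rfl hij
  rw [Matrix.det_apply, Finset.sum_eq_single 1]
  · simpa using prod_mem fun i _ => hmem (f i) (g i)
  · intro σ _ hσ
    have : ∃ i, bidiagonal v (f (σ i)) (g i) = 0 := by
      by_contra! hne
      apply hσ
      -- Nonzero entries force g i ≤ f (σ i) ≤ g i + 1. For i < j this gives f (σ i) ≤ g i + 1 ≤ g j
      -- ≤ f (σ j).
      have hmono : StrictMono σ := by
        refine Monotone.strictMono_of_injective (fun i j hij => ?_) σ.injective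
        rcases hij.eq_or_lt with rfl | hlt
        · exact le_rfl
        · have h1 := hentry _ _ (hne i)
          have h2 := hentry _ _ (hne j)
          have h3 : (g i).val < (g j).val := g.strictMono hlt
          have h4 : f (σ i) ≤ f (σ j) := by
            rw [Fin.le_def]; omega
          exact f.le_iff_le.1 h4
      ext i
      have : (σ : Fin s → Fin s) = id :=
        (hmono.range_inj strictMono_id).1 (by simp [σ.surjective.range_eq])
      simp [this]
    obtain ⟨i, hi⟩ := this
    rw [Finset.prod_eq_zero (Finset.mem_univ i) (by simpa using hi), smul_zero]
  · simp

/-- Adding `c` to the upper right corner of a matrix. -/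
theorem det_add_corner {s : ℕ} (M : Matrix (Fin (s + 1)) (Fin (s + 1)) R) (c : R) :
    (M.updateRow 0 (M 0 + c • Pi.single (Fin.last s) 1)).det =
      M.det + c * ((-1) ^ s * (M.submatrix Fin.succ Fin.castSucc).det) := by
  rw [Matrix.det_updateRow_add, Matrix.updateRow_eq_self, Matrix.det_updateRow_smul,
    Matrix.det_succ_row_zero (M.updateRow 0 _), Finset.sum_eq_single (Fin.last s)]
  · have hsub : (M.updateRow 0 (Pi.single (Fin.last s) 1)).submatrix Fin.succ
        (Fin.last s).succAbove = M.submatrix Fin.succ Fin.castSucc := by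
      ext i j
      simp
    rw [hsub]
    simp
  · intro j _ hj
    simp [Pi.single_eq_of_ne hj]
  · simp

end Minors

/-! ### Signs of the coefficients of a spectral polynomial. -/

section Twist

variable {R : Type*} [CommRing R]

/-- Polynomials `p` such that the coefficients of `p (ε x)` lie in `S`. -/
def twistedSubsemiring (S : Subsemiring R) (ε : ℤˣ) : Subsemiring R[X] where
  carrier := {p | ∀ i, (((ε ^ i : ℤˣ) : ℤ) : R) * p.coeff i ∈ S}
  mul_mem' {p r} hp hr i := by
    rw [coeff_mul, Finset.mul_sum]
    refine sum_mem fun x hx => ?_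
    rw [← Finset.HasAntidiagonal.mem_antidiagonal.1 hx, pow_add]
    have := mul_mem (hp x.1) (hr x.2)
    convert this using 1
    push_cast
    ring
  one_mem' i := by
    rw [coeff_one]
    split_ifs with h
    · subst h; simp
    · simp
  add_mem' hp hr i := by
    rw [coeff_add, mul_add]
    exact add_mem (hp i) (hr i)
  zero_mem' i := by simp

theorem C_mem_twistedSubsemiring {S : Subsemiring R} {ε : ℤˣ} {a : R} (ha : a ∈ S) :
    C a ∈ twistedSubsemiring S ε := by
  intro i
  rw [coeff_C]
  split_ifs with h
  · subst h; simpa using ha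
  · simp

theorem X_mul_mem_twistedSubsemiring (S : Subsemiring R) (ε : ℤˣ) :
    X * C (((ε : ℤˣ) : ℤ) : R) ∈ twistedSubsemiring S ε := by
  intro i
  match i with
  | 0 => simp
  | 1 =>
    rw [pow_one, coeff_X_mul, coeff_C_zero, ← Int.cast_mul, Int.units_coe_mul_self, Int.cast_one]
    exact one_mem S
  | i + 2 => rw [coeff_X_mul, coeff_C_succ, mul_zero]; exact zero_mem S

/-- The matrix is bidiagonal except for the corner x. In an s × s minor the corner can only occupy
the upper right position, with cofactor sign (-1)^{s-1}; the twist absorbs exactly this sign. -/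
theorem minorsIn_factorMatrix {S : Subsemiring R} {n : ℕ} {v : Fin n → R} (hv : ∀ j, v j ∈ S)
    (s : ℕ) : MinorsIn (twistedSubsemiring S ((-1) ^ (s + 1))) s (factorMatrix v) := by
  intro f g
  cases s with
  | zero => simp
  | succ s =>
    set B := (bidiagonal v).map (C : R → R[X]) with hB
    set c : R[X] := if (f 0).val = 0 ∧ (g (Fin.last s)).val + 1 = n then X else 0 with hc
    have hdecomp : (factorMatrix v).submatrix f g = (B.submatrix f g).updateRow 0
        ((B.submatrix f g) 0 + c • Pi.single (Fin.last s) 1) := by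
      ext1 i j
      have hcorner : (f i).val = 0 ∧ (g j).val + 1 = n ↔
          i = 0 ∧ j = Fin.last s ∧ (f 0).val = 0 ∧ (g (Fin.last s)).val + 1 = n := by
        constructor
        · rintro ⟨h1, h2⟩
          have hi : i = 0 := by
            have h3 : f i ≤ f 0 := by rw [Fin.le_def]; omega
            exact Fin.le_zero_iff.1 (f.le_iff_le.1 h3)
          have hj : j = Fin.last s := by
            have h3 : g (Fin.last s) ≤ g j := by
              rw [Fin.le_def]; have := (g (Fin.last s)).isLt; omega
            exact Fin.last_le_iff.1 (g.le_iff_le.1 h3)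
          subst hi hj
          exact ⟨rfl, rfl, h1, h2⟩
        · rintro ⟨rfl, rfl, h⟩
          exact h
      have hsplit : (factorMatrix v).submatrix f g i j = B.submatrix f g i j +
          if (f i).val = 0 ∧ (g j).val + 1 = n then X else 0 := by
        simp only [factorMatrix, shiftMatrix, hB, bidiagonal, Matrix.submatrix_apply,
          Matrix.add_apply, Matrix.of_apply, Matrix.map_apply, Matrix.diagonal_apply]
        by_cases h1 : f i = g j
        · have h2 : ¬ (f i).val = (g j).val + 1 := by rw [h1]; omega
          rw [if_neg h2, if_pos h1, if_pos h1, h1, add_comm]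
        · rw [if_neg h1, if_neg h1]
          by_cases h2 : (f i).val = (g j).val + 1
          · have h3 : ¬ ((f i).val = 0 ∧ (g j).val + 1 = n) := by omega
            rw [if_pos h2, if_pos h2, if_neg h3]
            simp
          · rw [if_neg h2, if_neg h2]
            simp
      rw [hsplit]
      by_cases hi : i = 0
      · subst hi
        rw [Matrix.updateRow_self]
        simp only [Pi.add_apply, Pi.smul_apply, smul_eq_mul]
        congr 1
        by_cases hj : j = Fin.last s
        · subst hj
          simp [hc]
        · rw [if_neg (by rw [hcorner]; tauto), Pi.single_eq_of_ne hj, mul_zero]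
      · rw [Matrix.updateRow_ne hi, if_neg (by rw [hcorner]; tauto), add_zero]
    rw [hdecomp, det_add_corner]
    have hminor : ∀ (t : ℕ) (f' g' : Fin t ↪o Fin n),
        (B.submatrix f' g').det ∈ twistedSubsemiring S ((-1) ^ (s + 1 + 1)) := by
      intro t f' g'
      have : B.submatrix f' g' = ((bidiagonal v).submatrix f' g').map (C : R →+* R[X]) := rfl
      rw [this, ← RingHom.mapMatrix_apply, ← RingHom.map_det]
      exact C_mem_twistedSubsemiring (minorsIn_bidiagonal hv t f' g')
    refine add_mem (hminor _ f g) ?_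
    rw [← mul_assoc]
    refine mul_mem ?_ (hminor s ((Fin.succOrderEmb s).trans f) (Fin.castSuccOrderEmb.trans g))
    rw [hc]
    split_ifs
    · have := X_mul_mem_twistedSubsemiring S ((-1) ^ (s + 1 + 1))
      convert this using 2
      push_cast
      simp [pow_succ]
    · simp

theorem minorsIn_laxMatrix {S : Subsemiring R} {m n k : ℕ} {q : Fin m → Fin n → R}
    (hq : ∀ i j, q i j ∈ S) (s : ℕ) :
    MinorsIn (twistedSubsemiring S ((-1) ^ (s + 1))) s (laxMatrix m n k q) := by
  refine MinorsIn.mul (MinorsIn.list_prod ?_) (MinorsIn.pow ?_ k)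
  · intro M hM
    obtain ⟨i, rfl⟩ := List.mem_ofFn.1 hM
    exact minorsIn_factorMatrix (hq i) s
  -- P(x) itself is the factor with zero diagonal.
  · have h := minorsIn_factorMatrix (S := S) (v := fun _ : Fin n => (0 : R))
      (fun _ => zero_mem S) s
    simpa [factorMatrix] using h

theorem spectralPoly_eq_charpoly (m n k : ℕ) (q : Fin m → Fin n → R) :
    spectralPoly m n k q = (-1) ^ n * (laxMatrix m n k q).charpoly := by
  rw [spectralPoly, Matrix.charpoly, Matrix.charmatrix, ← neg_sub, Matrix.det_neg,
    Fintype.card_fin]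
  rfl

/-- The sign `(-1)^{(n - b - 1) a + b}` as a unit of `ℤ`. -/
def signUnit (n : ℕ) (p : ℤ × ℤ) : ℤˣ := (-1) ^ (((n : ℤ) - p.2 - 1) * p.1 + p.2)

/-- The coefficient of y^j is (-1)^j times the sum of the principal minors of size s = n - j, which
lies in the twisted semiring. -/
theorem signUnit_mul_intCoeff_mem {S : Subsemiring R} {m n k : ℕ} {q : Fin m → Fin n → R}
    (hq : ∀ i j, q i j ∈ S) (p : ℤ × ℤ) :
    ((signUnit n p : ℤ) : R) * intCoeff (spectralPoly m n k q) p ∈ S := by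
  rw [intCoeff]
  split_ifs with hp
  swap
  · simp
  obtain ⟨a, b⟩ := p
  obtain ⟨i, rfl⟩ := Int.eq_ofNat_of_zero_le hp.1
  obtain ⟨j, rfl⟩ := Int.eq_ofNat_of_zero_le hp.2
  simp only [Int.toNat_natCast]
  rw [spectralPoly_eq_charpoly]
  by_cases hj : j ≤ n
  · obtain ⟨s, rfl⟩ := Nat.exists_eq_add_of_le' hj
    have hcoeff := Matrix.charpoly_coeff_eq_sum_minors (laxMatrix m (s + j) k q) s (by simp)
    rw [Fintype.card_fin, Nat.add_sub_cancel_left] at hcoeff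
    set σm := ∑ t ∈ (Finset.univ : Finset (Fin (s + j))).powersetCard s,
      ((laxMatrix m (s + j) k q).submatrix (Subtype.val : t → Fin (s + j)) Subtype.val).det
      with hS
    have hmem : σm ∈ twistedSubsemiring S ((-1) ^ (s + 1)) := by
      refine sum_mem fun t ht => ?_
      have hcard := (Finset.mem_powersetCard.1 ht).2
      rw [← Matrix.det_submatrix_equiv_self (t.orderIsoOfFin hcard).toEquiv]
      exact minorsIn_laxMatrix hq s (t.orderEmbOfFin hcard) (t.orderEmbOfFin hcard)
    have h1 : ((-1) ^ (s + j) * (laxMatrix m (s + j) k q).charpoly).coeff j =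
        (-1) ^ j * σm := by
      have : ((-1 : R[X][X]) ^ (s + j)) = C ((-1) ^ (s + j)) := by simp
      rw [this, coeff_C_mul, hcoeff, ← mul_assoc, ← pow_add]
      congr 1
      rw [show s + j + s = j + (s + s) by ring, pow_add, Even.neg_one_pow ⟨s, rfl⟩, mul_one]
    have h2 : ((-1 : R[X]) ^ j * σm).coeff i = (-1) ^ j * σm.coeff i := by
      have : ((-1 : R[X]) ^ j) = C ((-1) ^ j) := by simp
      rw [this, coeff_C_mul]
    rw [h1, h2]
    convert hmem i using 1
    rw [← mul_assoc]
    congr 1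
    -- The exponents (s - 1) i and (s + 1) i have the same parity.
    have hs : signUnit (s + j) ((i : ℤ), (j : ℤ)) = ((-1) ^ (s + 1)) ^ i * (-1) ^ j := by
      rw [signUnit, zpow_add, zpow_natCast]
      congr 1
      rw [← pow_mul, ← zpow_natCast]
      push_cast
      rw [show ((s : ℤ) + j - j - 1) * i = (s + 1) * i + (-2) * i by ring, zpow_add, zpow_mul _ (-2)]
      simp
    rw [hs]
    push_cast
    rw [mul_assoc, ← pow_add, Even.neg_one_pow ⟨j, rfl⟩, mul_one]
  · have hz : ((-1) ^ n * (laxMatrix m n k q).charpoly).coeff j = 0 := by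
      nontriviality R
      refine coeff_eq_zero_of_natDegree_lt ?_
      have : ((-1 : R[X][X]) ^ n) = C ((-1) ^ n) := by simp
      rw [this]
      refine (natDegree_C_mul_le _ _).trans_lt ?_
      rw [Matrix.charpoly_natDegree_eq_dim, Fintype.card_fin]
      omega
    rw [hz]
    simp

end Twist

/-! ### Determinants of cyclic block matrices. -/

section BlockMatrices

variable {A : Type*} [CommRing A] {m : ℕ} {ι : Type*} [Fintype ι]

/-- The matrix over `A` with the given square blocks. -/
abbrev ofBlocks (M : Matrix (Fin m) (Fin m) (Matrix ι ι A)) :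
    Matrix (Fin m × ι) (Fin m × ι) A :=
  Matrix.compRingEquiv (Fin m) ι A M

theorem ofBlocks_apply (M : Matrix (Fin m) (Fin m) (Matrix ι ι A)) (p r : Fin m × ι) :
    ofBlocks M p r = M p.1 r.1 p.2 r.2 := rfl

theorem ofBlocks_mulVec (M : Matrix (Fin m) (Fin m) (Matrix ι ι A)) (f : Fin m × ι → A)
    (p : Fin m × ι) :
    (ofBlocks M).mulVec f p = ∑ i, (M p.1 i).mulVec (fun a => f (i, a)) p.2 := by
  simp only [Matrix.mulVec, dotProduct, Fintype.sum_prod_type]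
  rfl

variable [DecidableEq ι]

theorem det_ofBlocks_of_upper {M : Matrix (Fin m) (Fin m) (Matrix ι ι A)}
    (h : ∀ i j, j < i → M i j = 0) : (ofBlocks M).det = ∏ i, (M i i).det := by
  have ht : (ofBlocks M).BlockTriangular Prod.fst := by
    intro p r hpr
    rw [ofBlocks_apply, h _ _ hpr]
    rfl
  rw [ht.det_fintype]
  refine Finset.prod_congr rfl fun i _ => ?_
  let e : ι ≃ {p : Fin m × ι // p.1 = i} :=
    { toFun := fun a => ⟨(i, a), rfl⟩
      invFun := fun p => p.1.2
      left_inv := fun a => rfl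
      right_inv := by rintro ⟨⟨_, a⟩, rfl⟩; rfl }
  rw [← Matrix.det_submatrix_equiv_self e]
  rfl

theorem det_ofBlocks_of_lower {M : Matrix (Fin m) (Fin m) (Matrix ι ι A)}
    (h : ∀ i j, i < j → M i j = 0) : (ofBlocks M).det = ∏ i, (M i i).det := by
  have : (ofBlocks M).transpose = ofBlocks (M.map Matrix.transpose).transpose := rfl
  rw [← Matrix.det_transpose, this, det_ofBlocks_of_upper]
  · exact Finset.prod_congr rfl fun i _ => Matrix.det_transpose _
  · intro i j hij
    simp [h j i hij]

/-- The block matrix of the cyclic shift `(u₀, …, u_{m-1}) ↦ (u₁, …, u_{m-1}, t u₀)`. -/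
def cyclicBlock {B : Type*} [Zero B] [One B] (m : ℕ) (t : B) : Matrix (Fin m) (Fin m) B :=
  Matrix.of fun i i' =>
    if i'.val = i.val + 1 then 1 else if i'.val = 0 ∧ i.val + 1 = m then t else 0

theorem det_cyclicBlock [NeZero m] (t : Matrix ι ι A) :
    ∃ ε : ℤˣ, (ofBlocks (cyclicBlock m t)).det = ((ε : ℤ) : A) * t.det := by
  obtain ⟨s, rfl⟩ := Nat.exists_eq_succ_of_ne_zero (NeZero.ne m)
  -- The cyclic block is diag(t, 1, …, 1) with its block rows rotated; only the sign of the rotation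
  -- enters.
  let D : Matrix (Fin (s + 1)) (Fin (s + 1)) (Matrix ι ι A) :=
    Matrix.diagonal fun i => if i = 0 then t else 1
  let σ : Equiv.Perm (Fin (s + 1) × ι) := (finRotate (s + 1)).prodCongr (Equiv.refl ι)
  have hσ : ofBlocks (cyclicBlock (s + 1) t) = (ofBlocks D).submatrix σ id := by
    ext ⟨i, a⟩ ⟨i', a'⟩
    change cyclicBlock (s + 1) t i i' a a' = D (finRotate (s + 1) i) i' a a'
    have hv := coe_finRotate i
    by_cases hl : i = Fin.last s
    · rw [if_pos hl] at hv
      have h0 : finRotate (s + 1) i = 0 := Fin.ext hv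
      subst hl
      simp only [cyclicBlock, D, h0, Matrix.of_apply, Matrix.diagonal_apply]
      have h1 : ¬ i'.val = (Fin.last s).val + 1 := by
        have := i'.isLt; simp only [Fin.val_last]; omega
      rw [if_neg h1]
      by_cases h2 : i' = 0
      · subst h2; simp
      · have h3 : ¬ i'.val = 0 := fun h => h2 (Fin.ext h)
        rw [if_neg (by tauto), if_neg (Ne.symm h2)]
    · rw [if_neg hl] at hv
      have hlt : ¬ i.val + 1 = s + 1 := fun h => hl (Fin.ext (by simpa using h))
      simp only [cyclicBlock, D, Matrix.of_apply, Matrix.diagonal_apply]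
      have h0 : finRotate (s + 1) i ≠ 0 := by
        intro h; rw [h] at hv; simp at hv
      rw [if_neg h0, if_neg (fun h : i'.val = 0 ∧ i.val + 1 = s + 1 => hlt h.2)]
      by_cases h1 : i'.val = i.val + 1
      · rw [if_pos h1, if_pos (Fin.ext (hv.trans h1.symm))]
      · rw [if_neg h1, if_neg (fun h => h1 (by rw [← h]; exact hv))]
  refine ⟨Equiv.Perm.sign σ, ?_⟩
  rw [hσ, Matrix.det_permute, det_ofBlocks_of_upper]
  · congr 1
    rw [Fin.prod_univ_succ]
    simp [D, Fin.succ_ne_zero]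
  · intro i j hij
    exact Matrix.diagonal_apply_ne _ hij.ne'

/-- This is block elimination around a cycle. The matrix factors as (1 - U)(1 - V), with U strictly
upper triangular and V supported in the first block column. -/
theorem det_one_sub_diagonal_mul_cyclicBlock [NeZero m] (c : Fin m → Matrix ι ι A)
    (t : Matrix ι ι A) :
    (ofBlocks (1 - Matrix.diagonal c * cyclicBlock m t)).det =
      (1 - (List.ofFn c).prod * t).det := by
  -- G i is the partial product c_i ⋯ c_{m-1} t; its recursion makes the spurious entries of the
  -- first column cancel in V - U V.
  let G : ℕ → Matrix ι ι A := fun i => ((List.ofFn c).drop i).prod * t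
  have hG : ∀ i : Fin m, G i = c i * G (i + 1) := by
    intro i
    have hi : i.val < (List.ofFn c).length := by simp
    simp only [G]
    rw [List.drop_eq_getElem_cons hi, List.prod_cons, mul_assoc]
    simp
  have hGm : G m = t := by
    simp only [G]
    rw [List.drop_of_length_le (by simp), List.prod_nil, one_mul]
  let U : Matrix (Fin m) (Fin m) (Matrix ι ι A) :=
    Matrix.of fun i i' => if i'.val = i.val + 1 then c i else 0
  let V : Matrix (Fin m) (Fin m) (Matrix ι ι A) :=
    Matrix.of fun i i' => if i'.val = 0 then G i else 0
  have hUV : U * V = Matrix.of fun i i' : Fin m =>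
      if i'.val = 0 then (if i.val + 1 = m then 0 else G i) else 0 := by
    ext1 i i'
    rw [Matrix.mul_apply]
    simp only [U, V, Matrix.of_apply]
    by_cases h0 : i'.val = 0
    · simp only [if_pos h0]
      by_cases hm : i.val + 1 = m
      · rw [if_pos hm]
        refine Finset.sum_eq_zero fun l _ => ?_
        rw [if_neg (by have := l.isLt; omega), zero_mul]
      · have hlt : i.val + 1 < m := by have := i.isLt; omega
        rw [if_neg hm, Finset.sum_eq_single ⟨i.val + 1, hlt⟩]
        · simp [hG i]
        · intro l _ hl
          rw [if_neg (fun h => hl (Fin.ext h)), zero_mul]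
        · simp
    · simp [h0]
  have hfac : 1 - Matrix.diagonal c * cyclicBlock m t = (1 - U) * (1 - V) := by
    have : Matrix.diagonal c * cyclicBlock m t = U + V - U * V := by
      rw [hUV]
      ext1 i i'
      rw [Matrix.diagonal_mul]
      simp only [cyclicBlock, U, V, Matrix.of_apply, Matrix.sub_apply, Matrix.add_apply]
      by_cases h0 : i'.val = 0
      · have h1 : ¬ i'.val = i.val + 1 := by omega
        by_cases hm : i.val + 1 = m
        · have : G i = c i * t := by rw [hG, hm, hGm]
          rw [if_neg h1, if_pos ⟨h0, hm⟩, if_neg h1, if_pos h0, if_pos h0, if_pos hm, this]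
          abel
        · rw [if_neg h1, if_neg (fun h => hm h.2), if_neg h1, if_pos h0, if_pos h0, if_neg hm]
          simp
      · by_cases h1 : i'.val = i.val + 1
        · rw [if_pos h1, if_pos h1, if_neg h0, if_neg h0]
          simp
        · rw [if_neg h1, if_neg (fun h => h0 h.1), if_neg h1, if_neg h0, if_neg h0]
          simp
    rw [this]
    noncomm_ring
  rw [hfac, ofBlocks, map_mul, Matrix.det_mul]
  change (ofBlocks (1 - U)).det * (ofBlocks (1 - V)).det = _
  have hU : (ofBlocks (1 - U)).det = 1 := by
    rw [det_ofBlocks_of_upper]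
    · refine Finset.prod_eq_one fun i _ => ?_
      simp [U]
    · intro i j hij
      have h1 : ¬ j.val = i.val + 1 := by rw [Fin.lt_def] at hij; omega
      simp [U, h1, Matrix.one_apply_ne hij.ne']
  have hV : (ofBlocks (1 - V)).det = (1 - G 0).det := by
    obtain ⟨s, rfl⟩ := Nat.exists_eq_succ_of_ne_zero (NeZero.ne m)
    rw [det_ofBlocks_of_lower, Fin.prod_univ_succ]
    · simp [V]
    · intro i j hij
      have h1 : ¬ j.val = 0 := by rw [Fin.lt_def] at hij; omega
      have h2 : ¬ j = 0 := fun h => h1 (by rw [h]; rfl)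
      simp [V, h2, Matrix.one_apply_ne hij.ne]
  rw [hU, hV, one_mul]
  simp [G]

end BlockMatrices

/-! ### The shift matrix and the symmetry under reversing the array. -/

section Shift

variable {A : Type*} [CommRing A]

/-- The value of the matrix `P(x)` at an element of a commutative ring. -/
def shiftAt (n : ℕ) (x : A) : Matrix (Fin n) (Fin n) A :=
  Matrix.of fun i j => if i.val = j.val + 1 then 1 else if i.val = 0 ∧ j.val + 1 = n then x else 0

theorem det_shiftAt (n : ℕ) [NeZero n] (x : A) :
    ∃ ε : ℤˣ, (shiftAt n x).det = ((ε : ℤ) : A) * x := by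
  obtain ⟨ε, hε⟩ := det_cyclicBlock (m := n) (Matrix.of fun _ _ : Unit => x)
  refine ⟨ε, ?_⟩
  rw [← Matrix.det_transpose]
  have h : (shiftAt n x).transpose = (ofBlocks (cyclicBlock n
      (Matrix.of fun _ _ : Unit => x))).submatrix (Equiv.prodPUnit (Fin n)).symm
        (Equiv.prodPUnit (Fin n)).symm := by
    ext i j
    simp only [shiftAt, Matrix.transpose_apply, Matrix.of_apply, Matrix.submatrix_apply,
      ofBlocks_apply, cyclicBlock]
    simp only [Equiv.prodPUnit_symm_apply]
    split_ifs <;> simp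
  rw [h, Matrix.det_submatrix_equiv_self, hε]
  simp

/-- Transposing L reverses the order of the factors, and conjugation by the index reversal restores
P. The power of P returns to the end because `charpoly` is invariant under cyclic permutation. This
undoes the decreasing order in `transposedArray`. -/
theorem spectralPoly_rev (m n k : ℕ) (q : Fin m → Fin n → A) :
    spectralPoly m n k (fun i j => q i.rev j.rev) = spectralPoly m n k q := by
  rw [spectralPoly_eq_charpoly, spectralPoly_eq_charpoly]
  congr 1
  have hP : Matrix.reindexAlgEquiv A[X] A[X] Fin.revPerm (shiftMatrix A n).transpose =
      shiftMatrix A n := by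
    ext1 i j
    simp only [Matrix.coe_reindexAlgEquiv, Matrix.reindex_apply, Matrix.submatrix_apply,
      Matrix.transpose_apply, shiftMatrix, Matrix.of_apply, Fin.revPerm_symm, Fin.revPerm_apply,
      Fin.val_rev]
    have := i.isLt
    have := j.isLt
    congr 1
    · simp only [eq_iff_iff]; omega
    · congr 1
      simp only [eq_iff_iff]; omega
  have hQ : ∀ i, Matrix.reindexAlgEquiv A[X] A[X] Fin.revPerm
      (factorMatrix (fun j => q i j.rev)).transpose = factorMatrix (q i) := by
    intro i
    rw [factorMatrix, Matrix.transpose_add, map_add, hP, Matrix.diagonal_transpose, factorMatrix]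
    congr 1
    ext1 a b
    simp only [Matrix.coe_reindexAlgEquiv, Matrix.reindex_apply, Matrix.submatrix_apply,
      Fin.revPerm_symm, Fin.revPerm_apply, Matrix.diagonal_apply, Fin.rev_rev, Fin.rev_inj]
  rw [← Matrix.charpoly_transpose, ← Matrix.charpoly_reindex Fin.revPerm,
    ← Matrix.coe_reindexAlgEquiv A[X] A[X], laxMatrix, laxMatrix, Matrix.transpose_mul, map_mul,
    Matrix.charpoly_mul_comm, Matrix.transpose_pow, map_pow, hP, Matrix.transpose_list_prod,
    map_list_prod]
  congr 3
  refine List.ext_getElem (by simp) fun i h1 h2 => ?_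
  simp only [List.getElem_map, List.getElem_reverse, List.getElem_ofFn, hQ]
  have h3 : i < m := by simpa using h2
  refine congrArg (fun a => factorMatrix (q a)) (Fin.ext ?_)
  simp only [List.length_map, List.length_ofFn, Fin.val_rev]
  omega

end Shift

/-! ### Quasi-periodic functions on ℤ² and the network operator. -/

section QuasiPeriodic

variable {A : Type*} [CommRing A]

/-- Functions on `ℤ²` that are multiplied by `x⁻¹` under the translation by `(0, n)` and by `y⁻¹`
under the translation by `(m, k)`. -/
def quasiPeriodic (x y : Aˣ) (m n k : ℕ) : Submodule A (ℤ → ℤ → A) where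
  carrier := {u | (∀ i j, u i (j + n) = ((x⁻¹ : Aˣ) : A) * u i j) ∧
    ∀ i j, u (i + m) (j + k) = ((y⁻¹ : Aˣ) : A) * u i j}
  add_mem' hu hv := by
    refine ⟨fun i j => ?_, fun i j => ?_⟩
    · simp only [Pi.add_apply, hu.1, hv.1, mul_add]
    · simp only [Pi.add_apply, hu.2, hv.2, mul_add]
  zero_mem' := by simp
  smul_mem' c u hu := by
    refine ⟨fun i j => ?_, fun i j => ?_⟩
    · simp only [Pi.smul_apply, hu.1, smul_eq_mul]; ring
    · simp only [Pi.smul_apply, hu.2, smul_eq_mul]; ring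

variable {x y : Aˣ} {m n k : ℕ}

theorem eq_zpow_mul_of_forall_add_one (F : ℤ → A) (c : Aˣ) (h : ∀ t, F (t + 1) = c * F t) (t : ℤ) :
    F t = ((c ^ t : Aˣ) : A) * F 0 := by
  induction t using Int.induction_on with
  | zero => simp
  | succ t ih => rw [h, ih, zpow_add_one, mul_comm (c ^ _), Units.val_mul, mul_assoc]
  | pred t ih =>
    have h1 := h (-(t : ℤ) - 1)
    rw [sub_add_cancel, ih] at h1
    rw [zpow_sub_one, mul_comm (c ^ _), Units.val_mul, mul_assoc, h1, Units.inv_mul_cancel_left]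

theorem apply_add_of_mem_quasiPeriodic {u : ℤ → ℤ → A} (hu : u ∈ quasiPeriodic x y m n k)
    (i j a b : ℤ) :
    u (i + m * a) (j + k * a + n * b) = ((y ^ (-a) * x ^ (-b) : Aˣ) : A) * u i j := by
  have h1 := eq_zpow_mul_of_forall_add_one (fun t => u (i + m * a) (j + k * a + n * t)) x⁻¹
    (fun t => by
      have := hu.1 (i + m * a) (j + k * a + n * t)
      rw [← this]; ring_nf) b
  have h2 := eq_zpow_mul_of_forall_add_one (fun t => u (i + m * t) (j + k * t)) y⁻¹
    (fun t => by
      have := hu.2 (i + m * t) (j + k * t)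
      rw [← this]; ring_nf) a
  simp only [mul_zero, add_zero] at h1 h2
  rw [h1, h2, ← mul_assoc, ← Units.val_mul, inv_zpow', inv_zpow', mul_comm (x ^ _)]

variable (x y m n k) in
/-- Values of a quasi-periodic function on a fundamental domain. -/
def restrictDomain : quasiPeriodic x y m n k →ₗ[A] (Fin m × Fin n → A) where
  toFun u p := u.1 p.1.val p.2.val
  map_add' _ _ := rfl
  map_smul' _ _ := rfl

/-- The quasi-periodic function with given values on a fundamental domain. -/
def extendDomain [NeZero m] [NeZero n] (x y : Aˣ) (k : ℕ) (f : Fin m × Fin n → A) : ℤ → ℤ → A :=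
  fun i j => ((y ^ (-(i / m)) * x ^ (-((j - k * (i / m)) / n)) : Aˣ) : A) *
    f (Fin.ofNat m (i % m).toNat, Fin.ofNat n ((j - k * (i / m)) % n).toNat)

theorem extendDomain_mem [NeZero m] [NeZero n] (f : Fin m × Fin n → A) :
    extendDomain x y k f ∈ quasiPeriodic x y m n k := by
  have hm : (m : ℤ) ≠ 0 := by exact_mod_cast NeZero.ne m
  have hn : (n : ℤ) ≠ 0 := by exact_mod_cast NeZero.ne n
  refine ⟨fun i j => ?_, fun i j => ?_⟩
  · have h1 : (j + n - k * (i / m)) = (j - k * (i / m)) + n * 1 := by ring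
    simp only [extendDomain]
    rw [h1, Int.add_mul_ediv_left _ _ hn, Int.add_mul_emod_self_left, ← mul_assoc, ← Units.val_mul]
    congr 2
    rw [neg_add, zpow_add]
    simp only [zpow_neg, zpow_one]
    rw [mul_comm x⁻¹, mul_assoc]
  · have h0 : i + m = i + m * 1 := by ring
    have h1 : j + k - k * (i / m + 1) = j - k * (i / m) := by ring
    simp only [extendDomain]
    rw [h0, Int.add_mul_ediv_left _ _ hm, Int.add_mul_emod_self_left, h1, ← mul_assoc,
      ← Units.val_mul]
    congr 2
    rw [neg_add, zpow_add]
    simp only [zpow_neg, zpow_one]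
    rw [mul_comm _ y⁻¹, mul_assoc]

theorem extendDomain_apply_fin [NeZero m] [NeZero n] (f : Fin m × Fin n → A) (i : Fin m)
    (j : Fin n) : extendDomain x y k f i.val j.val = f (i, j) := by
  have hi : (i.val : ℤ) / m = 0 := Int.ediv_eq_zero_of_lt (by omega) (by exact_mod_cast i.isLt)
  have hi' : (i.val : ℤ) % m = i.val := Int.emod_eq_of_lt (by omega) (by exact_mod_cast i.isLt)
  have hj : (j.val : ℤ) / n = 0 := Int.ediv_eq_zero_of_lt (by omega) (by exact_mod_cast j.isLt)
  have hj' : (j.val : ℤ) % n = j.val := Int.emod_eq_of_lt (by omega) (by exact_mod_cast j.isLt)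
  simp [extendDomain, hi, hi', hj, hj']

theorem eq_extendDomain [NeZero m] [NeZero n] {u : ℤ → ℤ → A}
    (hu : u ∈ quasiPeriodic x y m n k) :
    u = extendDomain x y k (fun p : Fin m × Fin n => u p.1.val p.2.val) := by
  funext i j
  have hm : 0 < (m : ℤ) := by exact_mod_cast NeZero.pos m
  have hn : 0 < (n : ℤ) := by exact_mod_cast NeZero.pos n
  -- Reduce the first coordinate by multiples of (m, k), then the second by multiples of (0, n).
  have h := apply_add_of_mem_quasiPeriodic hu (i % m) ((j - k * (i / m)) % n) (i / m)
    ((j - k * (i / m)) / n)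
  rw [Int.emod_add_mul_ediv, add_right_comm, Int.emod_add_mul_ediv, sub_add_cancel] at h
  rw [h, extendDomain]
  congr 2
  · have h1 := Int.emod_lt_of_pos i hm
    have h2 := Int.emod_nonneg i hm.ne'
    simp only [Fin.val_ofNat]
    rw [Nat.mod_eq_of_lt (by omega)]
    omega
  · have h1 := Int.emod_lt_of_pos (j - k * (i / m)) hn
    have h2 := Int.emod_nonneg (j - k * (i / m)) hn.ne'
    simp only [Fin.val_ofNat]
    rw [Nat.mod_eq_of_lt (by omega)]
    omega

theorem eq_of_mem_quasiPeriodic [NeZero m] [NeZero n] {u v : ℤ → ℤ → A}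
    (hu : u ∈ quasiPeriodic x y m n k) (hv : v ∈ quasiPeriodic x y m n k)
    (h : ∀ (i : Fin m) (j : Fin n), u i.val j.val = v i.val j.val) : u = v := by
  rw [eq_extendDomain hu, eq_extendDomain hv]
  congr 1
  exact _root_.funext fun p => h p.1 p.2

/-- Quasi-periodic functions form a free module with coordinates in a fundamental domain. -/
noncomputable def quasiPeriodicEquiv [NeZero m] [NeZero n] (x y : Aˣ) (k : ℕ) :
    quasiPeriodic x y m n k ≃ₗ[A] (Fin m × Fin n → A) :=
  { restrictDomain x y m n k with
    invFun := fun f => ⟨extendDomain x y k f, extendDomain_mem f⟩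
    left_inv := fun u => Subtype.ext (eq_extendDomain u.2).symm
    right_inv := fun f => _root_.funext fun p => extendDomain_apply_fin f p.1 p.2 }

theorem quasiPeriodicEquiv_apply [NeZero m] [NeZero n] (u : quasiPeriodic x y m n k)
    (p : Fin m × Fin n) : quasiPeriodicEquiv x y k u p = u.1 p.1.val p.2.val := rfl

variable (x y m n k) in
/-- The translation `u(i, j) ↦ u(i + s, j + t)`. -/
def translate (s t : ℤ) : quasiPeriodic x y m n k →ₗ[A] quasiPeriodic x y m n k where
  toFun u := ⟨fun i j => u.1 (i + s) (j + t), by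
    refine ⟨fun i j => ?_, fun i j => ?_⟩
    · beta_reduce; rw [add_right_comm j, u.2.1]
    · beta_reduce; rw [add_right_comm j, add_right_comm i, u.2.2]⟩
  map_add' _ _ := rfl
  map_smul' _ _ := rfl

/-- Multiplication by a periodic function. -/
def mulPeriodic (x y : Aˣ) (c : quasiPeriodic (1 : Aˣ) 1 m n k) :
    quasiPeriodic x y m n k →ₗ[A] quasiPeriodic x y m n k where
  toFun u := ⟨fun i j => c.1 i j * u.1 i j, by
    have h1 := c.2.1
    have h2 := c.2.2
    simp only [inv_one, Units.val_one, one_mul] at h1 h2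
    refine ⟨fun i j => ?_, fun i j => ?_⟩
    · beta_reduce; rw [u.2.1, h1]; ring
    · beta_reduce; rw [u.2.2, h2]; ring⟩
  map_add' u v := by ext i j; exact mul_add _ _ _
  map_smul' a u := by ext i j; exact mul_left_comm _ _ _

/-- The operator `u ↦ u(i - 1, j) - u(i, j - 1) - c(i - 1, j) u(i, j)`. -/
def networkOp (x y : Aˣ) (c : quasiPeriodic (1 : Aˣ) 1 m n k) :
    quasiPeriodic x y m n k →ₗ[A] quasiPeriodic x y m n k :=
  translate x y m n k (-1) 0 ∘ₗ (LinearMap.id -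
    translate x y m n k 1 (-1) - mulPeriodic x y c ∘ₗ translate x y m n k 1 0)

theorem networkOp_apply (c : quasiPeriodic (1 : Aˣ) 1 m n k) (u : quasiPeriodic x y m n k)
    (i j : ℤ) : (networkOp x y c u).1 i j =
      u.1 (i - 1) j - u.1 i (j - 1) - c.1 (i - 1) j * u.1 i j := by
  change u.1 (i + -1) (j + 0) - u.1 (i + -1 + 1) (j + 0 + -1) -
    c.1 (i + -1) (j + 0) * u.1 (i + -1 + 1) (j + 0 + 0) = _
  simp only [add_zero, ← sub_eq_add_neg, sub_add_cancel]

end QuasiPeriodic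

/-! ### The network operator has the spectral determinant. -/

section Determinant

variable {A : Type*} [CommRing A] {x y : Aˣ} {m n k : ℕ}

/-- The value of the matrix `Q_i(x)` at an element of a commutative ring. -/
def factorAt {n : ℕ} (x : A) (v : Fin n → A) : Matrix (Fin n) (Fin n) A :=
  shiftAt n x + Matrix.diagonal v

/-- The value of the Lax matrix at an element of a commutative ring. -/
def laxAt (m n k : ℕ) (x : A) (q : Fin m → Fin n → A) : Matrix (Fin n) (Fin n) A :=
  (List.ofFn fun i : Fin m => factorAt x (q i)).prod * shiftAt n x ^ k

theorem shiftAt_mulVec [NeZero n] (x : Aˣ) {g : ℤ → A}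
    (hg : ∀ j, g (j + n) = ((x⁻¹ : Aˣ) : A) * g j) (j : Fin n) :
    (shiftAt n (x : A)).mulVec (fun a => g a.val) j = g (j.val - 1) := by
  rw [Matrix.mulVec, dotProduct]
  by_cases h0 : j.val = 0
  · have hlt : n - 1 < n := Nat.sub_lt (NeZero.pos n) one_pos
    have hn := NeZero.pos n
    rw [Finset.sum_eq_single ⟨n - 1, hlt⟩]
    · have h1 := hg (j.val - 1)
      have h2 : (j.val : ℤ) - 1 + n = ((n - 1 : ℕ) : ℤ) := by omega
      rw [h2] at h1
      simp only [shiftAt, Matrix.of_apply]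
      rw [if_neg (by omega), if_pos ⟨h0, by omega⟩, h1, Units.mul_inv_cancel_left]
    · intro b _ hb
      simp only [shiftAt, Matrix.of_apply]
      rw [if_neg (by omega), if_neg (fun h => hb (Fin.ext (by simp only; omega))), zero_mul]
    · simp
  · have hlt : j.val - 1 < n := by omega
    rw [Finset.sum_eq_single ⟨j.val - 1, hlt⟩]
    · have h2 : ((j.val - 1 : ℕ) : ℤ) = j.val - 1 := by omega
      simp only [shiftAt, Matrix.of_apply]
      rw [if_pos (by omega), one_mul, h2]
    · intro b _ hb
      simp only [shiftAt, Matrix.of_apply]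
      rw [if_neg (fun h => hb (Fin.ext (by simp only; omega))), if_neg (fun h => h0 h.1), zero_mul]
    · simp

theorem shiftAt_pow_mulVec [NeZero n] (x : Aˣ) {g : ℤ → A}
    (hg : ∀ j, g (j + n) = ((x⁻¹ : Aˣ) : A) * g j) (k : ℕ) (j : Fin n) :
    (shiftAt n (x : A) ^ k).mulVec (fun a => g a.val) j = g (j.val - k) := by
  induction k generalizing g with
  | zero => simp
  | succ k ih =>
    rw [pow_succ, ← Matrix.mulVec_mulVec, funext (shiftAt_mulVec x hg)]
    rw [ih (g := fun t => g (t - 1)) (fun t => by rw [← hg]; ring_nf)]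
    push_cast
    ring_nf

theorem factorAt_mulVec [NeZero n] (x : Aˣ) {g : ℤ → A}
    (hg : ∀ j, g (j + n) = ((x⁻¹ : Aˣ) : A) * g j) (v : Fin n → A) (j : Fin n) :
    (factorAt (x : A) v).mulVec (fun a => g a.val) j = g (j.val - 1) + v j * g j.val := by
  rw [factorAt, Matrix.add_mulVec, Pi.add_apply, shiftAt_mulVec x hg, Matrix.mulVec_diagonal]

/-- In the last block row the translation leaves the fundamental domain: u(m, j) = y⁻¹ u(0, j - k),
so the wrap-around block is y⁻¹ P^k. -/
theorem ofBlocks_cyclicBlock_mulVec [NeZero m] [NeZero n] (u : quasiPeriodic x y m n k)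
    (p : Fin m × Fin n) :
    (ofBlocks (cyclicBlock m ((((y⁻¹ : Aˣ) : A)) • shiftAt n (x : A) ^ k))).mulVec
      (quasiPeriodicEquiv x y k u) p = u.1 (p.1.val + 1) p.2.val := by
  obtain ⟨i, j⟩ := p
  rw [ofBlocks_mulVec]
  simp only [quasiPeriodicEquiv_apply]
  by_cases h : i.val + 1 = m
  · have hm := NeZero.pos m
    rw [Finset.sum_eq_single ⟨0, hm⟩]
    · simp only [cyclicBlock, Matrix.of_apply]
      rw [if_neg (by omega), if_pos ⟨trivial, h⟩, Matrix.smul_mulVec, Pi.smul_apply,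
        shiftAt_pow_mulVec x (g := fun t => u.1 ((0 : ℕ) : ℤ) t) (u.2.1 _), smul_eq_mul, ← u.2.2]
      have : (i.val : ℤ) + 1 = m := by exact_mod_cast h
      simp [this]
    · intro b _ hb
      have hb' : ¬ b.val = 0 := fun h => hb (Fin.ext h)
      have hb2 := b.isLt
      simp only [cyclicBlock, Matrix.of_apply]
      rw [if_neg (by omega), if_neg (fun h => hb' h.1)]
      simp
    · simp
  · have hlt : i.val + 1 < m := by have := i.isLt; omega
    rw [Finset.sum_eq_single ⟨i.val + 1, hlt⟩]
    · simp [cyclicBlock]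
    · intro b _ hb
      have hb' : ¬ b.val = i.val + 1 := fun h => hb (Fin.ext h)
      simp only [cyclicBlock, Matrix.of_apply]
      rw [if_neg hb', if_neg (fun h' => h h'.2)]
      simp
    · simp

theorem det_eq_of_mulVec [NeZero m] [NeZero n]
    (L : quasiPeriodic x y m n k →ₗ[A] quasiPeriodic x y m n k)
    (M : Matrix (Fin m × Fin n) (Fin m × Fin n) A)
    (h : ∀ u, M.mulVec (quasiPeriodicEquiv x y k u) = quasiPeriodicEquiv x y k (L u)) :
    LinearMap.det L = M.det := by
  rw [← LinearMap.det_toLin', ← LinearMap.det_conj L (quasiPeriodicEquiv x y k)]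
  congr 1
  refine LinearMap.ext fun f => ?_
  simp only [LinearMap.comp_apply, LinearEquiv.coe_coe]
  rw [← h, LinearEquiv.apply_symm_apply, Matrix.toLin'_apply]

/-- The unit translation has determinant ± y^{-n} x^k, and the rest of the operator reduces to det(1
- y⁻¹ L(x)) = (-1)^n y^{-n} det(L(x) - y). The powers of y cancel and x^k remains. -/
theorem det_networkOp [NeZero m] [NeZero n] (c : quasiPeriodic (1 : Aˣ) 1 m n k) :
    ∃ ε : ℤˣ, LinearMap.det (networkOp x y c) * (x : A) ^ k = ((ε : ℤ) : A) *
      (laxAt m n k (x : A) (fun i j => c.1 i.val j.val) - Matrix.scalar (Fin n) (y : A)).det := by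
  set t := (((y⁻¹ : Aˣ) : A)) • shiftAt n (x : A) ^ k with ht
  set Q : Fin m → Matrix (Fin n) (Fin n) A := fun i => factorAt (x : A) fun j => c.1 i.val j.val
  have hshift : LinearMap.det (translate x y m n k 1 0) = (ofBlocks (cyclicBlock m t)).det := by
    refine det_eq_of_mulVec _ _ fun u => funext fun p => ?_
    rw [ofBlocks_cyclicBlock_mulVec, quasiPeriodicEquiv_apply]
    change _ = u.1 (_ + 1) (_ + 0)
    rw [add_zero]
  -- The extra translation cancels the one inside `networkOp`, leaving u_i - Q_i u_{i+1} in block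
  -- row i.
  have hmain : LinearMap.det (translate x y m n k 1 0 ∘ₗ networkOp x y c) =
      (ofBlocks (1 - Matrix.diagonal Q * cyclicBlock m t)).det := by
    refine det_eq_of_mulVec _ _ fun u => funext fun p => ?_
    have h1 : ofBlocks (1 - Matrix.diagonal Q * cyclicBlock m t) =
        1 - ofBlocks (Matrix.diagonal Q) * ofBlocks (cyclicBlock m t) := by
      simp only [ofBlocks, map_sub, map_one, map_mul]
    rw [h1, Matrix.sub_mulVec, Matrix.one_mulVec, ← Matrix.mulVec_mulVec,
      funext (ofBlocks_cyclicBlock_mulVec u), Pi.sub_apply, ofBlocks_mulVec,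
      Finset.sum_eq_single p.1]
    · rw [Matrix.diagonal_apply_eq, factorAt_mulVec x (g := u.1 (p.1.val + 1)) (u.2.1 _),
        quasiPeriodicEquiv_apply, quasiPeriodicEquiv_apply]
      change _ = (networkOp x y c u).1 (p.1.val + 1) (p.2.val + 0)
      rw [networkOp_apply]
      simp only [add_zero, add_sub_cancel_right]
      ring
    · intro b _ hb
      rw [Matrix.diagonal_apply_ne _ (Ne.symm hb), Matrix.zero_mulVec, Pi.zero_apply]
    · simp
  obtain ⟨ε₁, h₁⟩ := det_cyclicBlock (m := m) t
  obtain ⟨ε₂, h₂⟩ := det_shiftAt n (x : A)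
  have htdet : t.det = ((y⁻¹ : Aˣ) : A) ^ n * (((ε₂ : ℤ) : A) * x) ^ k := by
    rw [ht, Matrix.det_smul, Matrix.det_pow, h₂, Fintype.card_fin]
  have hlax : (1 - (List.ofFn Q).prod * t).det = ((y⁻¹ : Aˣ) : A) ^ n * ((-1) ^ n *
      (laxAt m n k (x : A) (fun i j => c.1 i.val j.val) - Matrix.scalar (Fin n) (y : A)).det) := by
    have hneg := Matrix.det_neg
      (laxAt m n k (x : A) (fun i j => c.1 i.val j.val) - Matrix.scalar (Fin n) (y : A))
    have hsmul := Matrix.det_smul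
      (-(laxAt m n k (x : A) (fun i j => c.1 i.val j.val) - Matrix.scalar (Fin n) (y : A)))
      ((y⁻¹ : Aˣ) : A)
    rw [Fintype.card_fin] at hneg hsmul
    rw [← hneg, ← hsmul]
    congr 1
    rw [neg_sub, smul_sub, ht, laxAt, Matrix.mul_smul]
    congr 1
    rw [Matrix.scalar_apply, ← Matrix.diagonal_smul, ← Matrix.diagonal_one]
    congr 1
    ext i
    simp
  rw [LinearMap.det_comp, hshift, h₁, htdet, det_one_sub_diagonal_mul_cyclicBlock, hlax] at hmain
  refine ⟨ε₁ * ε₂ ^ k * (-1) ^ n, ?_⟩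
  have hε : ((((ε₁ * ε₂ ^ k : ℤˣ)) : ℤ) : A) * (((ε₁ * ε₂ ^ k : ℤˣ) : ℤ) : A) = 1 := by
    rw [← Int.cast_mul, Int.units_coe_mul_self, Int.cast_one]
  set D := (laxAt m n k (x : A) (fun i j => c.1 i.val j.val) - Matrix.scalar (Fin n) (y : A)).det
  have hy : (y : A) ^ n * ((y⁻¹ : Aˣ) : A) ^ n = 1 := by
    rw [← mul_pow, Units.mul_inv, one_pow]
  push_cast at hε ⊢
  linear_combination ((y : A) ^ n * ((ε₁ : ℤ) * (ε₂ : ℤ) ^ k : A)) * hmain -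
    (LinearMap.det (networkOp x y c) * (x : A) ^ k) * ((y : A) ^ n * ((y⁻¹ : Aˣ) : A) ^ n) * hε -
    LinearMap.det (networkOp x y c) * (x : A) ^ k * hy +
    ((ε₁ : ℤ) * (ε₂ : ℤ) ^ k : A) * (-1) ^ n * D * hy

end Determinant

/-! ### Exchanging the two coordinates. -/

section Transposition

variable {A : Type*} [CommRing A]

/-- The monomial `z ^ a * y ^ b * x ^ c` in three units. -/
def unitMonomial (x y z : Aˣ) (a b c : ℤ) : Aˣ := z ^ a * y ^ b * x ^ c

theorem unitMonomial_mul (x y z : Aˣ) (a b c a' b' c' : ℤ) :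
    unitMonomial x y z a b c * unitMonomial x y z a' b' c' =
      unitMonomial x y z (a + a') (b + b') (c + c') := by
  simp only [unitMonomial, zpow_add]
  rw [mul_mul_mul_comm, mul_mul_mul_comm (z ^ a)]

theorem unitMonomial_zpow (x y z : Aˣ) (a b c t : ℤ) :
    unitMonomial x y z a b c ^ t = unitMonomial x y z (a * t) (b * t) (c * t) := by
  simp only [unitMonomial, mul_zpow, zpow_mul]

theorem unitMonomial_inv (x y z : Aˣ) (a b c : ℤ) :
    (unitMonomial x y z a b c)⁻¹ = unitMonomial x y z (-a) (-b) (-c) := by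
  rw [← zpow_neg_one, unitMonomial_zpow, mul_neg_one, mul_neg_one, mul_neg_one]

theorem zpow_eq_unitMonomial (x y z : Aˣ) (a : ℤ) : z ^ a = unitMonomial x y z a 0 0 := by
  simp [unitMonomial]

theorem zpow_mul_zpow_eq_unitMonomial (x y z : Aˣ) (b c : ℤ) :
    y ^ b * x ^ c = unitMonomial x y z 0 b c := by
  simp [unitMonomial]

/-- Reading a quasi-periodic function in the transposed coordinates:
`v(r, p) = z ^ (r + p) u(p + s, r + t)`. -/
def transposeEquiv {m n k N n' k' kbar : ℕ} {e : ℤ} (x y z : Aˣ) (s t : ℤ)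
    (hn : N * n' = n) (hk : N * k' = k) (he : (k' : ℤ) * kbar + e * n' = 1) :
    quasiPeriodic x y m n k ≃ₗ[A]
      quasiPeriodic (unitMonomial x y z (-(m * n')) n' (-k'))
        (unitMonomial x y z (-(N + kbar * m)) kbar e) N (m * n') (kbar * m) where
  toFun u := ⟨fun r p => ((z ^ (r + p) : Aˣ) : A) * u.1 (p + s) (r + t), by
    subst hn hk
    refine ⟨fun r p => ?_, fun r p => ?_⟩ <;> beta_reduce
    -- Lattice vector n'(m, k) - k'(0, n) = (m n', 0).
    · have h := apply_add_of_mem_quasiPeriodic u.2 (p + s) (r + t) n' (-k')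
      have h1 : p + s + m * n' = p + ((m * n' : ℕ) : ℤ) + s := by push_cast; ring
      have h2 : r + t + ((N * k' : ℕ) : ℤ) * n' + ((N * n' : ℕ) : ℤ) * -k' = r + t := by
        push_cast; ring
      rw [h1, h2] at h
      rw [h, ← mul_assoc, ← mul_assoc, ← Units.val_mul, ← Units.val_mul,
        zpow_mul_zpow_eq_unitMonomial x y z, zpow_eq_unitMonomial x y z,
        zpow_eq_unitMonomial x y z, unitMonomial_inv, unitMonomial_mul, unitMonomial_mul]
      congr 3 <;> push_cast <;> ring
    -- Lattice vector k̄'(m, k) + e(0, n) = (k̄' m, N), by the Bézout relation.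
    · have h := apply_add_of_mem_quasiPeriodic u.2 (p + s) (r + t) kbar e
      have h1 : p + s + m * kbar = p + ((kbar * m : ℕ) : ℤ) + s := by push_cast; ring
      have h2 : r + t + ((N * k' : ℕ) : ℤ) * kbar + ((N * n' : ℕ) : ℤ) * e = r + N + t := by
        push_cast; linear_combination (N : ℤ) * he
      rw [h1, h2] at h
      rw [h, ← mul_assoc, ← mul_assoc, ← Units.val_mul, ← Units.val_mul,
        zpow_mul_zpow_eq_unitMonomial x y z, zpow_eq_unitMonomial x y z,
        zpow_eq_unitMonomial x y z, unitMonomial_inv, unitMonomial_mul, unitMonomial_mul]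
      congr 3 <;> push_cast <;> ring⟩
  invFun v := ⟨fun i j => ((z ^ (-(j - t + (i - s))) : Aˣ) : A) * v.1 (j - t) (i - s), by
    subst hn hk
    refine ⟨fun i j => ?_, fun i j => ?_⟩ <;> beta_reduce
    -- The inverse base change: in the coordinates (r, p), (n, 0) = n'(N, k̄' m) - k̄'(0, m n'), and
    -- below (k, m) = k'(N, k̄' m) + e(0, m n').
    · have h := apply_add_of_mem_quasiPeriodic v.2 (j - t) (i - s) n' (-kbar)
      have h1 : j - t + N * n' = j + ((N * n' : ℕ) : ℤ) - t := by push_cast; ring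
      have h2 : i - s + ((kbar * m : ℕ) : ℤ) * n' + ((m * n' : ℕ) : ℤ) * -kbar = i - s := by
        push_cast; ring
      rw [h1, h2] at h
      rw [h, ← mul_assoc, ← mul_assoc, ← Units.val_mul, ← Units.val_mul, ← zpow_neg_one x]
      have h3 : x ^ (-1 : ℤ) = unitMonomial x y z 0 0 (-1) := by simp [unitMonomial]
      rw [h3, zpow_eq_unitMonomial x y z, zpow_eq_unitMonomial x y z, unitMonomial_zpow,
        unitMonomial_zpow, unitMonomial_mul, unitMonomial_mul, unitMonomial_mul]
      congr 3
      · push_cast; ring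
      · push_cast; ring
      · linear_combination -he
    · have h := apply_add_of_mem_quasiPeriodic v.2 (j - t) (i - s) k' e
      have h1 : j - t + N * k' = j + ((N * k' : ℕ) : ℤ) - t := by push_cast; ring
      have h2 : i - s + ((kbar * m : ℕ) : ℤ) * k' + ((m * n' : ℕ) : ℤ) * e = i + m - s := by
        push_cast; linear_combination (m : ℤ) * he
      rw [h1, h2] at h
      rw [h, ← mul_assoc, ← mul_assoc, ← Units.val_mul, ← Units.val_mul, ← zpow_neg_one y]
      have h3 : y ^ (-1 : ℤ) = unitMonomial x y z 0 (-1) 0 := by simp [unitMonomial]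
      rw [h3, zpow_eq_unitMonomial x y z, zpow_eq_unitMonomial x y z, unitMonomial_zpow,
        unitMonomial_zpow, unitMonomial_mul, unitMonomial_mul, unitMonomial_mul]
      congr 3
      · push_cast; linear_combination (m : ℤ) * he
      · linear_combination -he
      · push_cast; ring⟩
  map_add' u v := by
    ext r p
    exact mul_add _ _ _
  map_smul' a u := by
    ext r p
    exact mul_left_comm _ _ _
  left_inv u := by
    ext i j
    simp only [sub_add_cancel]
    rw [← mul_assoc, ← Units.val_mul, ← zpow_add, neg_add_cancel, zpow_zero, Units.val_one,
      one_mul]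
  right_inv v := by
    ext r p
    simp only [add_sub_cancel_right]
    rw [← mul_assoc, ← Units.val_mul, ← zpow_add, add_neg_cancel, zpow_zero, Units.val_one,
      one_mul]

theorem transposeEquiv_apply {m n k N n' k' kbar : ℕ} {e : ℤ} (x y z : Aˣ) (s t : ℤ)
    (hn : N * n' = n) (hk : N * k' = k) (he : (k' : ℤ) * kbar + e * n' = 1)
    (u : quasiPeriodic x y m n k) (r p : ℤ) :
    (transposeEquiv x y z s t hn hk he u).1 r p =
      ((z ^ (r + p) : Aˣ) : A) * u.1 (p + s) (r + t) := rfl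

/-- The two operators are conjugate. With z = -1 both neighbour terms change sign, which compensates
their exchange. The offsets m + 1 and -1 align c'(r - 1, p) with c(p + m, r - 1). -/
theorem det_networkOp_transpose {m n k N n' k' kbar : ℕ} {e : ℤ} (x y : Aˣ)
    (hn : N * n' = n) (hk : N * k' = k) (he : (k' : ℤ) * kbar + e * n' = 1)
    (c : quasiPeriodic (1 : Aˣ) 1 m n k) (c' : quasiPeriodic (1 : Aˣ) 1 N (m * n') (kbar * m))
    (hc : ∀ r p, c'.1 r p = c.1 (p + m) r) :
    LinearMap.det (networkOp (unitMonomial x y (-1) (-(m * n')) n' (-k'))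
        (unitMonomial x y (-1) (-(N + kbar * m)) kbar e) c') =
      LinearMap.det (networkOp x y c) := by
  rw [← LinearMap.det_conj (networkOp x y c) (transposeEquiv x y (-1) (m + 1) (-1) hn hk he)]
  congr 1
  refine LinearMap.ext fun v => ?_
  obtain ⟨u, rfl⟩ := (transposeEquiv x y (-1) (m + 1) (-1) hn hk he).surjective v
  simp only [LinearMap.comp_apply, LinearEquiv.coe_coe, LinearEquiv.symm_apply_apply]
  ext r p
  rw [networkOp_apply, transposeEquiv_apply, transposeEquiv_apply, transposeEquiv_apply,
    transposeEquiv_apply, networkOp_apply, hc]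
  have h1 : ((-1 : Aˣ) ^ (r - 1 + p)) = -(-1) ^ (r + p) := by
    rw [show r - 1 + p = r + p + -1 by ring, zpow_add]; simp
  have h2 : ((-1 : Aˣ) ^ (r + (p - 1))) = -(-1) ^ (r + p) := by
    rw [show r + (p - 1) = r + p + -1 by ring, zpow_add]; simp
  have h3 : p + ((m : ℤ) + 1) - 1 = p + m := by ring
  have h4 : p - 1 + ((m : ℤ) + 1) = p + m := by ring
  rw [h1, h2, h3, h4]
  simp only [Units.val_neg, ← sub_eq_add_neg]
  ring

/-- The periodic extension of an array of size `m × n`. -/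
def periodicExtension {m n : ℕ} [NeZero m] [NeZero n] (k : ℕ) (q : Fin m → Fin n → A) :
    quasiPeriodic (1 : Aˣ) 1 m n k :=
  ⟨extendDomain 1 1 k fun p => q p.1 p.2, extendDomain_mem _⟩

theorem periodicExtension_apply_fin {m n : ℕ} [NeZero m] [NeZero n] (k : ℕ)
    (q : Fin m → Fin n → A) (i : Fin m) (j : Fin n) :
    (periodicExtension k q).1 i.val j.val = q i j :=
  extendDomain_apply_fin (x := (1 : Aˣ)) (y := 1) (fun p : Fin m × Fin n => q p.1 p.2) i j

theorem periodicExtension_apply_add {m n : ℕ} [NeZero m] [NeZero n] (k : ℕ)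
    (q : Fin m → Fin n → A) (i j a b : ℤ) :
    (periodicExtension k q).1 (i + m * a) (j + k * a + n * b) = (periodicExtension k q).1 i j := by
  rw [apply_add_of_mem_quasiPeriodic (periodicExtension k q).2]
  simp

theorem periodicExtension_transposedArray {m n k kbar : ℕ} {e : ℤ} [NeZero m] [NeZero n]
    [NeZero (n.gcd k)] [NeZero (m * (n / n.gcd k))]
    (he : ((k / n.gcd k : ℕ) : ℤ) * kbar + e * ((n / n.gcd k : ℕ) : ℤ) = 1)
    (q : Fin m → Fin n → A) (r p : ℤ) :
    (periodicExtension (kbar * m) fun i j => transposedArray m n k q i.rev j.rev).1 r p =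
      (periodicExtension k q).1 (p + m) r := by
  have hn : n.gcd k * (n / n.gcd k) = n := Nat.mul_div_cancel' (Nat.gcd_dvd_left n k)
  have hk : n.gcd k * (k / n.gcd k) = k := Nat.mul_div_cancel' (Nat.gcd_dvd_right n k)
  have hmem : (fun r p => (periodicExtension k q).1 (p + m) r) ∈
      quasiPeriodic (1 : Aˣ) 1 (n.gcd k) (m * (n / n.gcd k)) (kbar * m) := by
    -- With trivial multipliers `transposeEquiv` yields the periodicity of the swapped array; it
    -- then suffices to compare on a fundamental domain.
    have h := (transposeEquiv 1 1 1 m 0 hn hk he (periodicExtension k q)).2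
    have hfun : (transposeEquiv 1 1 1 m 0 hn hk he (periodicExtension k q)).1 =
        fun r p => (periodicExtension k q).1 (p + m) r := by
      funext r p
      rw [transposeEquiv_apply]
      simp
    rw [hfun] at h
    simpa only [unitMonomial, one_zpow, mul_one] using h
  refine congrFun (congrFun (eq_of_mem_quasiPeriodic (periodicExtension (kbar * m)
    fun i j => transposedArray m n k q i.rev j.rev).2 hmem ?_) r) p
  intro i j
  rw [periodicExtension_apply_fin]
  simp only [transposedArray]
  have hm := NeZero.pos m
  obtain ⟨n', hn'⟩ : ∃ n', n' = n / n.gcd k := ⟨_, rfl⟩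
  obtain ⟨k', hk'⟩ : ∃ k', k' = k / n.gcd k := ⟨_, rfl⟩
  have hj : j.val < n' * m := by rw [hn', mul_comm _ m]; exact j.isLt
  have hjrev : j.rev.val = m * n' - (j.val + 1) := by rw [Fin.val_rev, hn']
  rw [← hn'] at hn
  rw [← hk'] at hk
  have ha : j.val / m < n' := (Nat.div_lt_iff_lt_mul hm).2 hj
  have hb : j.val % m < m := Nat.mod_lt _ hm
  have hab : m * (j.val / m) + j.val % m = j.val := Nat.div_add_mod _ _
  set a := j.val / m
  set b := j.val % m
  have hrev : j.rev.val = (m - 1 - b) + m * (n' - 1 - a) := by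
    rw [hjrev, ← hab]
    obtain ⟨a', ha'⟩ := Nat.exists_eq_add_of_lt ha
    have : n' - 1 - a = a' := by omega
    rw [this, ha']
    have : m * (a + a' + 1) = m * a + m * a' + m := by ring
    omega
  have hdiv : j.rev.val / m = n' - 1 - a := by
    rw [hrev, Nat.add_mul_div_left _ _ hm, Nat.div_eq_of_lt (by omega), zero_add]
  have hmod : j.rev.val % m = m - 1 - b := by
    rw [hrev, Nat.add_mul_mod_self_left, Nat.mod_eq_of_lt (by omega)]
  have hi : n.gcd k - 1 - i.rev.val = i.val := by
    rw [Fin.val_rev]; have := i.isLt; omega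
  rw [hdiv, hmod, hi, ← periodicExtension_apply_fin k q]
  have hb' : m - 1 - (m - 1 - b) = b := by omega
  rw [hb', Fin.val_ofNat, Fin.val_ofNat, Nat.mod_eq_of_lt hb]
  -- Since n' k = n k', this lattice translation carries the entry of q selected by
  -- `transposedArray` to the position (j + m, i).
  have h := periodicExtension_apply_add k q (b : ℤ) (((i.val + (n' - 1 - a) * k) % n : ℕ) : ℤ)
    (a + 1) (((i.val + (n' - 1 - a) * k) / n : ℕ) - k')
  rw [← h]
  have hdm : (((i.val + (n' - 1 - a) * k) % n : ℕ) : ℤ) +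
      n * (((i.val + (n' - 1 - a) * k) / n : ℕ) : ℤ) = i.val + (n' - 1 - a) * k := by
    have h5 := Nat.mod_add_div (i.val + (n' - 1 - a) * k) n
    have h6 : ((n' - 1 - a : ℕ) : ℤ) = n' - 1 - a := by omega
    rw [← h6]
    exact_mod_cast h5
  refine congrArg₂ (periodicExtension k q).1 ?_ ?_
  · rw [← hab]; push_cast; ring
  · have hn2 : (n : ℤ) = n.gcd k * n' := by exact_mod_cast hn.symm
    have hk2 : (k : ℤ) = n.gcd k * k' := by exact_mod_cast hk.symm
    have h7 : (n : ℤ) * k' = k * n' := by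
      linear_combination (k' : ℤ) * hn2 - n' * hk2
    linear_combination hdm - h7

end Transposition

/-! ### Evaluation and change of the coefficient ring. -/

section Evaluation

variable {R A : Type*} [CommRing R] [CommRing A]

/-- Evaluation of a polynomial in `x` and `y` at two elements of a ring. -/
noncomputable def evalPair (φ : R →+* A) (x y : A) : R[X][X] →+* A :=
  eval₂RingHom (eval₂RingHom φ x) y

theorem mapMatrix_shiftMatrix (φ : R →+* A) (x : A) (n : ℕ) :
    (eval₂RingHom φ x).mapMatrix (shiftMatrix R n) = shiftAt n x := by
  ext i j
  simp only [RingHom.mapMatrix_apply, Matrix.map_apply, shiftMatrix, shiftAt, Matrix.of_apply]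
  split_ifs <;> simp

theorem mapMatrix_factorMatrix (φ : R →+* A) (x : A) {n : ℕ} (v : Fin n → R) :
    (eval₂RingHom φ x).mapMatrix (factorMatrix v) = factorAt x fun j => φ (v j) := by
  rw [factorMatrix, map_add, mapMatrix_shiftMatrix, factorAt]
  congr 1
  rw [RingHom.mapMatrix_apply, Matrix.diagonal_map (map_zero _)]
  congr 1
  ext j
  simp

theorem evalPair_spectralPoly (φ : R →+* A) (x y : A) (m n k : ℕ) (q : Fin m → Fin n → R) :
    evalPair φ x y (spectralPoly m n k q) =
      (laxAt m n k x (fun i j => φ (q i j)) - Matrix.scalar (Fin n) y).det := by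
  have hlax : (eval₂RingHom φ x).mapMatrix (laxMatrix m n k q) =
      laxAt m n k x fun i j => φ (q i j) := by
    rw [laxMatrix, map_mul, map_pow, mapMatrix_shiftMatrix, map_list_prod, List.map_ofFn, laxAt]
    congr 3
    ext1 i
    exact mapMatrix_factorMatrix φ x (q i)
  rw [spectralPoly, RingHom.map_det, map_sub, ← hlax]
  congr 2
  · ext i j
    simp [evalPair]
  · ext i j
    by_cases h : i = j
    · subst h; simp [evalPair]
    · simp [h]

theorem spectralPoly_map (f : R →+* A) (m n k : ℕ) (q : Fin m → Fin n → R) :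
    spectralPoly m n k (fun i j => f (q i j)) =
      (spectralPoly m n k q).map (mapRingHom f) := by
  have hP : (mapRingHom f).mapMatrix (shiftMatrix R n) = shiftMatrix A n := by
    ext1 i j
    simp only [RingHom.mapMatrix_apply, Matrix.map_apply, shiftMatrix, Matrix.of_apply]
    split_ifs <;> simp
  have hQ : ∀ v : Fin n → R, (mapRingHom f).mapMatrix (factorMatrix v) =
      factorMatrix fun j => f (v j) := by
    intro v
    rw [factorMatrix, map_add, hP, factorMatrix]
    congr 1
    rw [RingHom.mapMatrix_apply, Matrix.diagonal_map (map_zero _)]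
    congr 1
    ext1 j
    simp
  have hlax : (mapRingHom f).mapMatrix (laxMatrix m n k q) =
      laxMatrix m n k fun i j => f (q i j) := by
    rw [laxMatrix, map_mul, map_pow, hP, map_list_prod, List.map_ofFn, laxMatrix]
    congr 3
    ext1 i
    exact hQ (q i)
  rw [← coe_mapRingHom, spectralPoly, spectralPoly, RingHom.map_det, map_sub, ← hlax]
  congr 2
  · ext1 i j
    simp
  · ext1 i j
    by_cases h : i = j
    · subst h; simp
    · simp [h]

theorem intCoeff_map (f : R →+* A) (g : R[X][X]) (p : ℤ × ℤ) :
    intCoeff (g.map (mapRingHom f)) p = f (intCoeff g p) := by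
  simp only [intCoeff]
  split_ifs <;> simp

end Evaluation

/-! ### Reading off coefficients after a monomial substitution. -/

section Laurent

variable {R : Type*} [CommRing R]

/-- Monomials with sign in the ring of Laurent polynomials in two variables. -/
noncomputable def signedMonomial (R : Type*) [CommRing R] :
    Multiplicative (ℤ × ℤ) × ℤˣ →* (AddMonoidAlgebra R (ℤ × ℤ))ˣ :=
  MonoidHom.toHomUnits
    { toFun := fun g => AddMonoidAlgebra.single g.1.toAdd ((g.2 : ℤ) : R)
      map_one' := by simp [AddMonoidAlgebra.one_def]
      map_mul' := fun g h => by simp [AddMonoidAlgebra.single_mul_single] }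

theorem val_signedMonomial (g : Multiplicative (ℤ × ℤ) × ℤˣ) :
    (signedMonomial R g : AddMonoidAlgebra R (ℤ × ℤ)) =
      AddMonoidAlgebra.single g.1.toAdd ((g.2 : ℤ) : R) := rfl

theorem intCoeff_add (f g : R[X][X]) (p : ℤ × ℤ) :
    intCoeff (f + g) p = intCoeff f p + intCoeff g p := by
  simp only [intCoeff]
  split_ifs <;> simp

/-- Independence of g₁ and g₂ prevents distinct monomials of f from colliding. Negative a or b are
never reached, in agreement with the default value of `intCoeff`. -/
theorem coeff_evalPair_signedMonomial (f : R[X][X]) (g₁ g₂ : ℤ × ℤ) (ε₁ ε₂ : ℤˣ)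
    (hinj : ∀ a b a' b' : ℤ, a • g₁ + b • g₂ = a' • g₁ + b' • g₂ → a = a' ∧ b = b') (a b : ℤ) :
    (evalPair AddMonoidAlgebra.singleZeroRingHom
      (signedMonomial R (Multiplicative.ofAdd g₁, ε₁) : AddMonoidAlgebra R (ℤ × ℤ))
      (signedMonomial R (Multiplicative.ofAdd g₂, ε₂) : AddMonoidAlgebra R (ℤ × ℤ)) f).coeff
      (a • g₁ + b • g₂) = (((ε₁ ^ a * ε₂ ^ b : ℤˣ) : ℤ) : R) * intCoeff f (a, b) := by
  induction f using Polynomial.induction_on' with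
  | add f g hf hg =>
    rw [RingHom.map_add, AddMonoidAlgebra.coeff_add, Finsupp.add_apply, hf, hg, intCoeff_add, mul_add]
  | monomial j p =>
    induction p using Polynomial.induction_on' with
    | add f g hf hg =>
      rw [LinearMap.map_add, RingHom.map_add, AddMonoidAlgebra.coeff_add, Finsupp.add_apply, hf,
        hg, intCoeff_add, mul_add]
    | monomial i c =>
      have hval : evalPair AddMonoidAlgebra.singleZeroRingHom
          (signedMonomial R (Multiplicative.ofAdd g₁, ε₁) : AddMonoidAlgebra R (ℤ × ℤ))
          (signedMonomial R (Multiplicative.ofAdd g₂, ε₂) : AddMonoidAlgebra R (ℤ × ℤ))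
          (monomial j (monomial i c)) = AddMonoidAlgebra.single ((i : ℤ) • g₁ + (j : ℤ) • g₂)
            (c * (((ε₁ ^ i * ε₂ ^ j : ℤˣ) : ℤ) : R)) := by
        simp only [evalPair, coe_eval₂RingHom, eval₂_monomial]
        rw [← Units.val_pow_eq_pow_val, ← Units.val_pow_eq_pow_val, ← map_pow, ← map_pow,
          val_signedMonomial, val_signedMonomial]
        simp [AddMonoidAlgebra.single_mul_single, mul_assoc]
      rw [hval, AddMonoidAlgebra.coeff_single, Finsupp.single_apply]
      by_cases h : (i : ℤ) = a ∧ (j : ℤ) = b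
      · obtain ⟨rfl, rfl⟩ := h
        simp [intCoeff, mul_comm]
      · rw [if_neg fun h' => h (hinj _ _ _ _ h')]
        have : intCoeff (monomial j (monomial i c)) (a, b) = 0 := by
          rw [intCoeff]
          split_ifs with hp
          · simp only at hp ⊢
            rw [coeff_monomial]
            split_ifs with h2
            · rw [coeff_monomial, if_neg]
              intro h3
              apply h
              omega
            · simp
          · rfl
        rw [this, mul_zero]

end Laurent

/-! ### The affine map on exponents. -/

section ExponentMap

theorem exponentMap_spec {m n k kbar n' k' : ℕ} {e : ℤ} (hn' : n / n.gcd k = n')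
    (hk' : k / n.gcd k = k') (hpos : 0 < n') (he : (k' : ℤ) * kbar + e * n' = 1) (i j : ℤ) :
    exponentMap m n k kbar (i, j) =
      (kbar * (k + m) + (-kbar * i + e * j), -n' * k + (n' * i + k' * j)) := by
  have : (1 - (k' : ℤ) * kbar) / n' = e :=
    Int.ediv_eq_of_eq_mul_left (by omega) (by linear_combination -he)
  simp only [exponentMap, hn', hk', this]

theorem exponentMap_bijective {m n k kbar n' k' : ℕ} {e : ℤ} (hn' : n / n.gcd k = n')
    (hk' : k / n.gcd k = k') (hpos : 0 < n') (he : (k' : ℤ) * kbar + e * n' = 1) :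
    Function.Bijective (exponentMap m n k kbar) := by
  -- The linear part has determinant -(k' k̄' + e n') = -1, hence an integral inverse.
  refine Function.bijective_iff_has_inverse.2 ⟨fun p => (k + k' * kbar * m - k' * p.1 + e * p.2,
    -n' * kbar * m + n' * p.1 + kbar * p.2), ?_, ?_⟩
  · rintro ⟨i, j⟩
    rw [exponentMap_spec hn' hk' hpos he]
    ext
    · linear_combination (i - k : ℤ) * he
    · linear_combination (j : ℤ) * he
  · rintro ⟨a, b⟩
    rw [exponentMap_spec hn' hk' hpos he]
    ext
    · linear_combination (a - kbar * m : ℤ) * he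
    · linear_combination (b : ℤ) * he

end ExponentMap

/-! ### Comparison of coefficients up to sign. -/

section Comparison

variable {R : Type*} [CommRing R] {m n k kbar : ℕ} [NeZero m] [NeZero n]

/-- Two applications of `det_networkOp`, to c and to the swapped c', share one determinant;
cross-multiplying by the powers of x and X eliminates it. -/
theorem evalPair_transposedSpectralPoly {A : Type*} [CommRing A] {n' k' : ℕ} {e : ℤ}
    (hn' : n / n.gcd k = n') (hk' : k / n.gcd k = k')
    (he : (k' : ℤ) * kbar + e * n' = 1) (φ : R →+* A) (x y : Aˣ) (q : Fin m → Fin n → R) :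
    ∃ ε : ℤˣ, evalPair φ (x : A) (y : A) (spectralPoly m n k q) *
        (unitMonomial x y (-1) (-(m * n')) n' (-k') : A) ^ (kbar * m) =
      ((ε : ℤ) : A) * (evalPair φ (unitMonomial x y (-1) (-(m * n')) n' (-k') : A)
        (unitMonomial x y (-1) (-(n.gcd k + kbar * m)) kbar e : A)
        (transposedSpectralPoly m n k kbar q) * (x : A) ^ k) := by
  subst hn' hk'
  have hg : 0 < n.gcd k := Nat.gcd_pos_of_pos_left _ (NeZero.pos n)
  have hq : 0 < n / n.gcd k :=
    Nat.div_pos (Nat.le_of_dvd (NeZero.pos n) (Nat.gcd_dvd_left n k)) hg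
  have : NeZero (n.gcd k) := ⟨hg.ne'⟩
  have : NeZero (m * (n / n.gcd k)) := ⟨(Nat.mul_pos (NeZero.pos m) hq).ne'⟩
  have hn : n.gcd k * (n / n.gcd k) = n := Nat.mul_div_cancel' (Nat.gcd_dvd_left n k)
  have hk : n.gcd k * (k / n.gcd k) = k := Nat.mul_div_cancel' (Nat.gcd_dvd_right n k)
  let c := periodicExtension k fun i j => φ (q i j)
  let c' := periodicExtension (kbar * m) fun i j =>
    transposedArray m n k (fun i j => φ (q i j)) i.rev j.rev
  have hc : ∀ r p, c'.1 r p = c.1 (p + m) r := periodicExtension_transposedArray he _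
  have hdet := det_networkOp_transpose x y hn hk he c c' hc
  set X := unitMonomial x y (-1) (-(m * (n / n.gcd k : ℕ))) (n / n.gcd k : ℕ) (-(k / n.gcd k : ℕ))
  set Y := unitMonomial x y (-1) (-(n.gcd k + kbar * m)) kbar e
  obtain ⟨ε, h⟩ := det_networkOp (x := x) (y := y) c
  obtain ⟨ε', h'⟩ := det_networkOp (x := X) (y := Y) c'
  have hψ : evalPair φ (x : A) (y : A) (spectralPoly m n k q) =
      (laxAt m n k (x : A) (fun i j => c.1 i.val j.val) - Matrix.scalar (Fin n) (y : A)).det := by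
    rw [evalPair_spectralPoly]
    simp only [c, periodicExtension_apply_fin]
  have hψ' : evalPair φ (X : A) (Y : A) (transposedSpectralPoly m n k kbar q) =
      (laxAt (n.gcd k) (m * (n / n.gcd k)) (kbar * m) (X : A) (fun i j => c'.1 i.val j.val) -
        Matrix.scalar (Fin (m * (n / n.gcd k))) (Y : A)).det := by
    rw [transposedSpectralPoly, ← spectralPoly_rev, evalPair_spectralPoly]
    simp only [c', periodicExtension_apply_fin]
    rfl
  rw [← hψ] at h
  rw [← hψ', hdet] at h'
  have hε : ((ε : ℤ) : A) * ((ε : ℤ) : A) = 1 := by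
    rw [← Int.cast_mul, Int.units_coe_mul_self, Int.cast_one]
  refine ⟨ε * ε', ?_⟩
  push_cast
  set ψ := evalPair φ (x : A) (y : A) (spectralPoly m n k q)
  linear_combination (-((ε : ℤ) : A) * (X : A) ^ (kbar * m)) * h + ((ε : ℤ) : A) * (x : A) ^ k * h'
    - ψ * (X : A) ^ (kbar * m) * hε

theorem intCoeff_spectralPoly_transpose {n' k' : ℕ} {e : ℤ}
    (hn' : n / n.gcd k = n') (hk' : k / n.gcd k = k') (hpos : 0 < n')
    (he : (k' : ℤ) * kbar + e * n' = 1) (q : Fin m → Fin n → R) (p : ℤ × ℤ) :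
    ∃ ε : ℤˣ, intCoeff (spectralPoly m n k q) p =
      ((ε : ℤ) : R) * intCoeff (transposedSpectralPoly m n k kbar q) (exponentMap m n k kbar p) := by
  obtain ⟨i, j⟩ := p
  let x := signedMonomial R (Multiplicative.ofAdd (1, 0), 1)
  let y := signedMonomial R (Multiplicative.ofAdd (0, 1), 1)
  have hmon : ∀ a b c : ℤ, unitMonomial x y (-1) a b c =
      signedMonomial R (Multiplicative.ofAdd (c, b), (-1) ^ a) := by
    intro a b c
    have hz : (-1 : (AddMonoidAlgebra R (ℤ × ℤ))ˣ) = signedMonomial R (1, -1) := by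
      ext1
      rw [val_signedMonomial]
      simp [AddMonoidAlgebra.one_def]
    simp only [unitMonomial, hz, x, y, ← map_zpow, ← map_mul]
    congr 1
    ext
    · simp
    · simp
    · simp
  obtain ⟨ε, h⟩ := evalPair_transposedSpectralPoly (m := m) hn' hk' he
    (AddMonoidAlgebra.singleZeroRingHom : R →+* AddMonoidAlgebra R (ℤ × ℤ)) x y q
  rw [hmon, hmon] at h
  have hL := coeff_evalPair_signedMonomial (spectralPoly m n k q) (1, 0) (0, 1) 1 1
    (fun a b a' b' h => by simpa using h) i j
  have hR := coeff_evalPair_signedMonomial (transposedSpectralPoly m n k kbar q)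
    (-k', n') (e, kbar) ((-1) ^ (-(m * n' : ℤ))) ((-1) ^ (-(n.gcd k + kbar * m : ℤ)))
    (fun a b a' b' h => by
      simp only [Prod.smul_mk, smul_eq_mul, Prod.mk_add_mk, Prod.mk.injEq] at h
      obtain ⟨h1, h2⟩ := h
      constructor
      · linear_combination (a' - a) * he - kbar * h1 + e * h2
      · linear_combination (b' - b) * he + n' * h1 + k' * h2)
    (exponentMap m n k kbar (i, j)).1 (exponentMap m n k kbar (i, j)).2
  set E := evalPair (AddMonoidAlgebra.singleZeroRingHom : R →+* AddMonoidAlgebra R (ℤ × ℤ))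
    (x : AddMonoidAlgebra R (ℤ × ℤ)) (y : AddMonoidAlgebra R (ℤ × ℤ)) (spectralPoly m n k q)
  generalize evalPair (AddMonoidAlgebra.singleZeroRingHom : R →+* AddMonoidAlgebra R (ℤ × ℤ))
    (signedMonomial R (Multiplicative.ofAdd (-(k' : ℤ), (n' : ℤ)), (-1) ^ (-(m * n' : ℤ))) :
      AddMonoidAlgebra R (ℤ × ℤ))
    (signedMonomial R (Multiplicative.ofAdd (e, (kbar : ℤ)), (-1) ^ (-(n.gcd k + kbar * m : ℤ))) :
      AddMonoidAlgebra R (ℤ × ℤ)) (transposedSpectralPoly m n k kbar q) = E' at h hR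
  have hsign : ((ε : ℤ) : AddMonoidAlgebra R (ℤ × ℤ)) =
      AddMonoidAlgebra.single 0 ((ε : ℤ) : R) := by
    rcases Int.units_eq_one_or ε with rfl | rfl <;> simp [AddMonoidAlgebra.one_def]
  rw [hsign, ← Units.val_pow_eq_pow_val, ← Units.val_pow_eq_pow_val, ← map_pow, ← map_pow,
    val_signedMonomial, val_signedMonomial] at h
  -- The shift by k̄' m (-k', n') is the exponent of X^{k̄' m}, so that the left side gives the
  -- coefficient of x^i y^j in ψ.
  have hcoeff := congrArg (fun F => AddMonoidAlgebra.coeff F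
    ((i, j) + (kbar * m) • ((-k', n') : ℤ × ℤ))) h
  beta_reduce at hcoeff
  rw [AddMonoidAlgebra.coeff_mul_single_apply, AddMonoidAlgebra.coeff_single_mul_apply,
    AddMonoidAlgebra.coeff_mul_single_apply] at hcoeff
  have hP : (i, j) + (kbar * m) • ((-k', n') : ℤ × ℤ) +
      -(Multiplicative.toAdd ((Multiplicative.ofAdd ((-k', n') : ℤ × ℤ),
        ((-1) ^ (-(m * n' : ℤ)) : ℤˣ)) ^ (kbar * m)).1) = i • (1, 0) + j • (0, 1) := by
    simp
  have hQ : -0 + ((i, j) + (kbar * m) • ((-k', n') : ℤ × ℤ)) +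
      -(Multiplicative.toAdd ((Multiplicative.ofAdd ((1, 0) : ℤ × ℤ), (1 : ℤˣ)) ^ k).1) =
      (exponentMap m n k kbar (i, j)).1 • ((-k', n') : ℤ × ℤ) +
        (exponentMap m n k kbar (i, j)).2 • ((e, kbar) : ℤ × ℤ) := by
    rw [exponentMap_spec hn' hk' hpos he]
    ext
    · simp
      linear_combination (k - i : ℤ) * he
    · simp
      linear_combination (-j : ℤ) * he
  have hone : ((Multiplicative.ofAdd ((1, 0) : ℤ × ℤ), (1 : ℤˣ)) ^ k).2 = 1 := by simp
  rw [hP, hL, hQ, hR, hone, Prod.pow_snd] at hcoeff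
  generalize ((-1 : ℤˣ) ^ (-(m * n' : ℤ))) ^ (kbar * m) = σ at hcoeff
  generalize ((-1 : ℤˣ) ^ (-(m * n' : ℤ))) ^ (exponentMap m n k kbar (i, j)).1 *
    ((-1 : ℤˣ) ^ (-(n.gcd k + kbar * m : ℤ))) ^ (exponentMap m n k kbar (i, j)).2 = ρ at hcoeff
  have hσ : ((σ : ℤ) : R) * ((σ : ℤ) : R) = 1 := by
    rw [← Int.cast_mul, Int.units_coe_mul_self, Int.cast_one]
  refine ⟨σ * ε * ρ, ?_⟩
  simp only [one_zpow, mul_one, Units.val_one, Int.cast_one, one_mul, Prod.mk.eta] at hcoeff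
  push_cast
  linear_combination ((σ : ℤ) : R) * hcoeff - intCoeff (spectralPoly m n k q) (i, j) * hσ

end Comparison

/-! ### Nonnegative coefficients determine the sign. -/

section Positivity

variable {σ : Type*}

/-- Polynomials with nonnegative integer coefficients. -/
noncomputable def nonnegPolynomials (σ : Type*) : Subsemiring (MvPolynomial σ ℤ) :=
  (MvPolynomial.map (Nat.castRingHom ℤ)).rangeS

theorem map_natCast_injective :
    Function.Injective (MvPolynomial.map (σ := σ) (Nat.castRingHom ℤ)) :=
  MvPolynomial.map_injective _ Nat.cast_injective

/-- If the sign is -1 then w + w' = 0, and over ℕ both vanish. -/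
theorem eq_of_map_eq_sign_mul_map {w w' : MvPolynomial σ ℕ} {ε : ℤˣ}
    (h : MvPolynomial.map (Nat.castRingHom ℤ) w =
      ((ε : ℤ) : MvPolynomial σ ℤ) * MvPolynomial.map (Nat.castRingHom ℤ) w') : w = w' := by
  rcases Int.units_eq_one_or ε with rfl | rfl
  · exact map_natCast_injective (by simpa using h)
  · have h0 : w + w' = 0 := by
      apply map_natCast_injective
      rw [map_add, h, map_zero]
      simp
    have hz : ∀ d, w.coeff d = 0 ∧ w'.coeff d = 0 := by
      intro d
      have := congrArg (MvPolynomial.coeff d) h0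
      rw [MvPolynomial.coeff_add, MvPolynomial.coeff_zero] at this
      omega
    ext d
    rw [(hz d).1, (hz d).2]

theorem eval₂Hom_map_natCast (g : σ → ℂ) (w : MvPolynomial σ ℕ) :
    MvPolynomial.eval₂Hom (Int.castRingHom ℂ) g (MvPolynomial.map (Nat.castRingHom ℤ) w) =
      MvPolynomial.aeval g w := by
  rw [MvPolynomial.eval₂Hom_map_hom, MvPolynomial.aeval_def, MvPolynomial.coe_eval₂Hom]
  congr 1

theorem monomialSign_eq_signUnit (n : ℕ) (p : ℤ × ℤ) :
    monomialSign n p = ((signUnit n p : ℤ) : ℂ) := by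
  have h := map_zpow (Units.map (Int.castRingHom ℂ).toMonoidHom) (-1)
    (((n : ℤ) - p.2 - 1) * p.1 + p.2)
  have h' := congrArg Units.val h
  have hneg : ((Units.map (Int.castRingHom ℂ).toMonoidHom (-1) : ℂˣ) : ℂ) = -1 := by simp
  rw [Units.val_zpow_eq_zpow_val, hneg] at h'
  exact h'.symm

end Positivity

end ToricNetwork

/-! ### The theorem: generic array over ℤ, then specialization to ℂ. -/

open ToricNetwork

theorem proposition10p3 (n m k kbar : ℕ) [NeZero n] [NeZero m] (hk : k ≤ n)
    (hkbar : kbar < n / n.gcd k)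
    (hinv : (k / n.gcd k) * kbar ≡ 1 [MOD n / n.gcd k]) :
    Function.Bijective (ToricNetwork.exponentMap m n k kbar) ∧
    ∃ w : ℤ × ℤ → MvPolynomial (Fin m × Fin n) ℕ,
      ∀ (q : Fin m → Fin n → ℂ) (p : ℤ × ℤ),
        ToricNetwork.intCoeff (ToricNetwork.spectralPoly m n k q) p =
          ToricNetwork.monomialSign n p *
            MvPolynomial.aeval (fun s : Fin m × Fin n => q s.1 s.2) (w p) ∧
        ToricNetwork.intCoeff (ToricNetwork.transposedSpectralPoly m n k kbar q)
            (ToricNetwork.exponentMap m n k kbar p) =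
          ToricNetwork.monomialSign (m * (n / n.gcd k))
              (ToricNetwork.exponentMap m n k kbar p) *
            MvPolynomial.aeval (fun s : Fin m × Fin n => q s.1 s.2) (w p) := by
  have hpos : 0 < n / n.gcd k := Nat.zero_lt_of_lt hkbar
  obtain ⟨e, he⟩ : ∃ e : ℤ, ((k / n.gcd k : ℕ) : ℤ) * kbar + e * ((n / n.gcd k : ℕ) : ℤ) = 1 := by
    obtain ⟨e, he⟩ := (Nat.modEq_iff_dvd).1 hinv
    refine ⟨e, ?_⟩
    push_cast at he ⊢
    linear_combination -he
  refine ⟨exponentMap_bijective rfl rfl hpos he, ?_⟩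
  -- For independent variables as entries, nonnegativity is a statement about polynomials and the
  -- unknown sign can be eliminated.
  let q₀ : Fin m → Fin n → MvPolynomial (Fin m × Fin n) ℤ := fun i j => MvPolynomial.X (i, j)
  have hq₀ : ∀ i j, q₀ i j ∈ nonnegPolynomials (Fin m × Fin n) :=
    fun i j => ⟨MvPolynomial.X (i, j), MvPolynomial.map_X _ _⟩
  have hψ : ∀ p, ∃ w : MvPolynomial (Fin m × Fin n) ℕ, MvPolynomial.map (Nat.castRingHom ℤ) w =
      ((signUnit n p : ℤ) : MvPolynomial (Fin m × Fin n) ℤ) *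
        intCoeff (spectralPoly m n k q₀) p :=
    fun p => signUnit_mul_intCoeff_mem hq₀ p
  have hψ' : ∀ p, ∃ w : MvPolynomial (Fin m × Fin n) ℕ, MvPolynomial.map (Nat.castRingHom ℤ) w =
      ((signUnit (m * (n / n.gcd k)) p : ℤ) : MvPolynomial (Fin m × Fin n) ℤ) *
        intCoeff (transposedSpectralPoly m n k kbar q₀) p :=
    fun p => signUnit_mul_intCoeff_mem (fun _ _ => hq₀ _ _) p
  choose w hw using hψ
  choose w' hw' using hψ'
  have hsq : ∀ ε : ℤˣ, ((ε : ℤ) : MvPolynomial (Fin m × Fin n) ℤ) * ((ε : ℤ) : _) = 1 := by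
    intro ε
    rw [← Int.cast_mul, Int.units_coe_mul_self, Int.cast_one]
  have hww' : ∀ p, w p = w' (exponentMap m n k kbar p) := by
    intro p
    obtain ⟨ε, hε⟩ := intCoeff_spectralPoly_transpose (m := m) rfl rfl hpos he q₀ p
    refine eq_of_map_eq_sign_mul_map (ε := signUnit n p * ε *
      signUnit (m * (n / n.gcd k)) (exponentMap m n k kbar p)) ?_
    rw [hw, hw', hε]
    push_cast
    linear_combination (-((signUnit n p : ℤ) : MvPolynomial (Fin m × Fin n) ℤ) * ((ε : ℤ) : _) *
      intCoeff (transposedSpectralPoly m n k kbar q₀) (exponentMap m n k kbar p)) *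
      hsq (signUnit (m * (n / n.gcd k)) (exponentMap m n k kbar p))
  have specialize : ∀ (q : Fin m → Fin n → ℂ) (s : ℤˣ) (c : MvPolynomial (Fin m × Fin n) ℤ)
      (v : MvPolynomial (Fin m × Fin n) ℕ),
      MvPolynomial.map (Nat.castRingHom ℤ) v = ((s : ℤ) : MvPolynomial (Fin m × Fin n) ℤ) * c →
      MvPolynomial.eval₂Hom (Int.castRingHom ℂ) (fun s : Fin m × Fin n => q s.1 s.2) c =
        ((s : ℤ) : ℂ) * MvPolynomial.aeval (fun s : Fin m × Fin n => q s.1 s.2) v := by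
    intro q s c v h
    rw [← eval₂Hom_map_natCast, h, map_mul, map_intCast, ← mul_assoc, ← Int.cast_mul,
      Int.units_coe_mul_self, Int.cast_one, one_mul]
  refine ⟨w, fun q p => ⟨?_, ?_⟩⟩
  · rw [monomialSign_eq_signUnit, ← specialize q _ _ _ (hw p), ← intCoeff_map, ← spectralPoly_map]
    simp [q₀]
  · rw [monomialSign_eq_signUnit, hww', ← specialize q _ _ _ (hw' _), ← intCoeff_map,
      transposedSpectralPoly, transposedSpectralPoly, ← spectralPoly_map]
    simp [q₀, transposedArray]
    rfl
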